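/- A $2$-edge-coloured graph is a pair $(G,s)$ where $G$ is a finite simple graph and $s:E(G)\to\{+,-\}$. A homomorphism $(G,s)\to(H,t)$ is a graph homomorphism $\phi:G\to H$ with $s(uv)=t(\phi(u)\phi(v))$ for every edge $uv$ of $G$. A $k$-colouring of $(G,s)$ is a homomorphism of $(G,s)$ to some $2$-edge-coloured graph with exactly $k$ vertices. The chromatic number $\chi((G,s))$ is the least $k$ such that $(G,s)$ admits a $k$-colouring, and for a family $\mathcal F$ of $2$-edge-coloured graphs, $\chi(\mathcal F)$ is the least $k$ such that $\chi(F)\le k$ for all $F\in\mathcal F$. Let $\mathcal G_3^c$ be the family of connected $2$-edge-coloured cubic (that is, $3$-regular) graphs. Then $$8\le \chi(\mathcal G_3^c)\le 10,$$ and there is a connected $2$-edge-coloured cubic graph with chromatic number exactly $8$. -/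

import Mathlib

universe u v

/-- The two edge colours `+` and `-`. -/
inductive EdgeColour where
  | pos : EdgeColour
  | neg : EdgeColour
  deriving DecidableEq

/-- A (finite) 2-edge-coloured graph `(G, s)`: a finite simple graph `G` together with an
arbitrary map `s : E(G) → {+, -}`. -/
structure TwoEdgeColouredGraph where
  /-- the vertex set -/
  V : Type u
  [fintypeV : Fintype V]
  /-- the underlying simple graph -/
  graph : SimpleGraph V
  /-- the edge colouring -/
  sign : graph.edgeSet → EdgeColour

namespace TwoEdgeColouredGraph

attribute [instance] TwoEdgeColouredGraph.fintypeV

/-- `φ` is a homomorphism `(G, s) → (H, t)`: a graph homomorphism that preserves edge colours. -/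
def IsHom (G : TwoEdgeColouredGraph.{u}) (H : TwoEdgeColouredGraph.{v})
    (φ : G.graph →g H.graph) : Prop :=
  ∀ e : G.graph.edgeSet, G.sign e = H.sign (φ.mapEdgeSet e)

/-- `(G, s)` admits a `k`-colouring: a homomorphism to some 2-edge-coloured graph `H`
with exactly `k` vertices. -/
def Colourable (G : TwoEdgeColouredGraph.{u}) (k : ℕ) : Prop :=
  ∃ H : TwoEdgeColouredGraph.{0}, Fintype.card H.V = k ∧ ∃ φ : G.graph →g H.graph, IsHom G H φ

/-- The chromatic number of `(G, s)`: the least `k` such that `(G, s)` admits a `k`-colouring. -/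
noncomputable def chromaticNumber (G : TwoEdgeColouredGraph.{u}) : ℕ∞ :=
  sInf {k : ℕ∞ | ∃ n : ℕ, k = n ∧ G.Colourable n}

/-- The chromatic number of a family of 2-edge-coloured graphs: the least `k` such that
every member of the family has chromatic number at most `k` (`⊤` if there is no finite one). -/
noncomputable def familyChromaticNumber (F : Set TwoEdgeColouredGraph.{u}) : ℕ∞ :=
  sInf {k : ℕ∞ | ∀ G ∈ F, G.chromaticNumber ≤ k}

open Classical in
/-- The family of connected 2-edge-coloured cubic graphs. -/
def connectedCubic : Set TwoEdgeColouredGraph.{u} :=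
  {G | G.graph.Connected ∧ G.graph.IsRegularOfDegree 3}

end TwoEdgeColouredGraph

/-! The bound 8 comes from `octa`, a cubic graph on eight vertices in which no two vertices can be
identified: nonadjacent vertices have a common neighbour that sees them with different signs
(`octaMatrix_clique`).

For the bound 10 the main target is `rook`, a complete signed graph on nine vertices whose positive
and negative parts are both strongly regular with parameters (9,4,1,2). Prescribed signs towards two
different colours can always be met, and in at least two ways, except in one rigid case: two signs
`a` towards a pair of sign `a` leave only the third vertex of a monochromatic triangle. Rigidity
makes one configuration uncolourable, a monochromatic K4 with an edge `pq` subdivided by `d` in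
different signs: the K4 forces one colour on `p` and `q`, while `d` forces two.

`exists_rook_colouring` shows that this is the only obstacle for subcubic graphs without cubic
components. The induction removes a vertex of degree at most two. The hard case is that of two
neighbours `u`, `w` joined to it with different signs; they must receive different colours
(`exists_separating_colouring`). This is achieved by recolouring around `u`, by colouring a smaller
graph with an auxiliary edge of sign `-a`, or by applying a fixed-point-free automorphism of `rook`
to a union of components that contains `u` but not `w`.

Now let a graph be connected and cubic. If it contains an obstruction, delete the obstruction: the
rest maps to the ten-vertex graph `rookTop`, and the map extends
(`IsObstruction.exists_rookTop_colouring`). If not, delete a single vertex `v`, map the rest to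
`rook`, and give `v` a tenth colour. This works when neighbours of `v` joined with different signs
have different colours, which a double count (`exists_few_sameOff`) makes possible for some `v`. -/

/-! ### Signed adjacency matrices and the two targets. -/

/-- A graph on `V` with signed edges, given by its signed adjacency matrix. -/
structure Signing (V : Type*) where
  /-- the sign of a pair of vertices, `0` when they are not adjacent -/
  sgn : V → V → SignType
  symm : ∀ x y, sgn x y = sgn y x
  irrefl : ∀ x, sgn x x = 0

namespace Signing

instance {V : Type*} : CoeFun (Signing V) (fun _ => V → V → SignType) := ⟨Signing.sgn⟩

/-- `φ` maps every signed edge of `G` to a pair of the same sign in the sign matrix `T`. -/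
def IsColouring {V C : Type*} (G : Signing V) (T : C → C → SignType) (φ : V → C) : Prop :=
  ∀ x y, G x y ≠ 0 → T (φ x) (φ y) = G x y

/-- The rook's graph on a `3 × 3` board: positive along lines, negative otherwise. -/
def rook (i j : Fin 9) : SignType :=
  if i = j then 0 else if i.1 / 3 = j.1 / 3 ∨ i.1 % 3 = j.1 % 3 then 1 else -1

/-- The rook's graph with a further vertex. -/
def rookTop : Option (Fin 9) → Option (Fin 9) → SignType
  | some i, some j => rook i j
  | none, none => 0
  | some i, none => if i = 0 ∨ i = 1 ∨ i = 3 then 1 else -1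
  | none, some i => if i = 0 ∨ i = 1 ∨ i = 3 then 1 else -1

/-- Translation of the rook's graph by one row. -/
def rookShift (i : Fin 9) : Fin 9 := i + 3

/-! ### Finite extension properties of the targets. -/

theorem rook_symm : ∀ i j, rook i j = rook j i := by decide

theorem rook_self : ∀ i, rook i i = 0 := by decide

theorem rookTop_symm : ∀ i j, rookTop i j = rookTop j i := by decide

theorem rookTop_self : ∀ i, rookTop i i = 0 := by decide

theorem rookShift_rook : ∀ i j, rook (rookShift i) (rookShift j) = rook i j := by decide

theorem rookShift_ne : ∀ i, rookShift i ≠ i := by decide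

theorem rook_extend_one : ∀ p f a, a ≠ 0 → ∃ c, c ≠ f ∧ rook c p = a := by decide

set_option maxRecDepth 10000 in
theorem rook_extend_same : ∀ p q a, a ≠ 0 → ∃ c, rook c p = a ∧ rook c q = a := by decide

-- In either sign, adjacent vertices have one common neighbour and nonadjacent ones two. Hence at
-- least two colours `c` meet the demands outside the excluded cases, and one of them avoids `f`.
set_option maxRecDepth 100000 in
set_option maxHeartbeats 2000000 in
theorem rook_extend_two : ∀ p q a b f, a ≠ 0 → b ≠ 0 → (p = q → a = b) → (a = b → rook p q ≠ a) →
    ∃ c, c ≠ f ∧ rook c p = a ∧ rook c q = b := by decide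

theorem rook_extend_ne : ∀ p q a b, a ≠ 0 → b ≠ 0 → p ≠ q →
    ∃ c, rook c p = a ∧ rook c q = b := by
  intro p q a b ha hb hpq
  by_cases h : a = b
  · subst h; exact rook_extend_same p q a ha
  · obtain ⟨c, -, hc⟩ := rook_extend_two p q a b 0 ha hb (fun h => absurd h hpq)
      (fun h' => absurd h' h)
    exact ⟨c, hc⟩

-- Two triangles with different apexes `u`, `u'` leave one apex off any forbidden colour, so the
-- forbidden colour need not enter the finite check. In the excluded case `x`, `y`, `c` form a
-- triangle of sign `a`, and the apex can only be `c`.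
set_option synthInstance.maxHeartbeats 400000 in
set_option synthInstance.maxSize 2000 in
set_option maxRecDepth 100000 in
set_option maxHeartbeats 4000000 in
theorem rook_two_triangles : ∀ c d p q a, p ≠ 0 → q ≠ 0 → a ≠ 0 → (c = d → p = a → q ≠ a) →
    ∃ x, rook x c = p ∧ ∃ y, rook y d = q ∧ rook x y = a ∧ ∃ u, rook u x = a ∧ rook u y = a ∧
      ∃ x', rook x' c = p ∧ ∃ y', rook y' d = q ∧ rook x' y' = a ∧
        ∃ u', u' ≠ u ∧ rook u' x' = a ∧ rook u' y' = a := by decide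

theorem rook_triangle (c d : Fin 9) (p q a : SignType) (f : Fin 9) (hp : p ≠ 0) (hq : q ≠ 0)
    (ha : a ≠ 0) (h : c = d → p = a → q ≠ a) :
    ∃ x, rook x c = p ∧ ∃ y, rook y d = q ∧ rook x y = a ∧
      ∃ u, u ≠ f ∧ rook u x = a ∧ rook u y = a := by
  obtain ⟨x, hx, y, hy, hxy, u, hux, huy, x', hx', y', hy', hxy', u', hne, hux', huy'⟩ :=
    rook_two_triangles c d p q a hp hq ha h
  by_cases hf : u = f
  · exact ⟨x', hx', y', hy', hxy', u', hf ▸ hne, hux', huy'⟩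
  · exact ⟨x, hx, y, hy, hxy, u, hf, hux, huy⟩

theorem rook_triangle_one : ∀ c a, a ≠ 0 → ∃ x, rook c x = a ∧ ∃ y, rook c y = a ∧ rook x y = a := by
  decide

theorem rook_third : ∀ p q a, rook p q = a → a ≠ 0 → ∃ c, rook c p = a ∧ rook c q = a := by
  decide

set_option maxRecDepth 100000 in
set_option maxHeartbeats 4000000 in
theorem rook_split_mid : ∀ d f a b, a ≠ 0 → b ≠ 0 → ∃ p, rook d p = a ∧
    ∃ u, u ≠ f ∧ rook u d = a ∧ rook u p = a ∧ ∃ r, rook p r = b ∧ ∃ s, rook p s = b ∧ rook r s = b := by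
  decide

set_option synthInstance.maxHeartbeats 400000 in
set_option synthInstance.maxSize 2000 in
set_option maxRecDepth 100000 in
set_option maxHeartbeats 4000000 in
theorem rook_split_side : ∀ d f a b, a ≠ 0 → b ≠ 0 → ∃ p, rook d p = b ∧ ∃ q, rook d q = -b ∧
    ∃ r, rook q r = -a ∧ ∃ s, rook p s = -a ∧ rook q s = -a ∧ rook r s = -a ∧
    ∃ u, u ≠ f ∧ rook u p = a ∧ rook u r = a := by
  decide

set_option synthInstance.maxHeartbeats 400000 in
set_option synthInstance.maxSize 2000 in
set_option maxRecDepth 100000 in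
set_option maxHeartbeats 4000000 in
theorem rook_split_rung : ∀ d f a b, a ≠ 0 → b ≠ 0 → ∃ p, rook d p = b ∧ ∃ q, rook d q = -b ∧
    ∃ r, rook p r = -a ∧ rook q r = -a ∧ ∃ s, rook p s = -a ∧ rook q s = -a ∧
    ∃ u, u ≠ f ∧ rook u r = a ∧ rook u s = a := by
  decide

-- The tenth vertex breaks rigidity: in `rookTop` the positive pair `0`, `1` has both `2` and `none`
-- as common positive neighbours, so the ends of a K4 minus an edge can have different colours.
set_option synthInstance.maxHeartbeats 400000 in
set_option synthInstance.maxSize 2000 in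
set_option maxRecDepth 100000 in
set_option maxHeartbeats 4000000 in
theorem rookTop_obstruction : ∀ c a b e, a ≠ 0 → b ≠ 0 → e ≠ 0 → ∃ d, rookTop d c = a ∧
    ∃ p, rookTop d p = b ∧ ∃ q, rookTop d q = -b ∧ ∃ r, rookTop p r = e ∧ rookTop q r = e ∧
    ∃ s, rookTop p s = e ∧ rookTop q s = e ∧ rookTop r s = e := by
  decide


theorem sign_neg_ne_zero : ∀ t : SignType, t ≠ 0 → -t ≠ 0 := by decide

theorem sign_neg_neg : ∀ t : SignType, - -t = t := by decide

theorem sign_ne_neg : ∀ t : SignType, t ≠ 0 → t ≠ -t := by decide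

theorem sign_eq_neg_of_ne : ∀ s t : SignType, s ≠ 0 → t ≠ 0 → s ≠ t → s = -t := by decide

/-! ### Edge surgery, extension of colourings, obstructions. -/

section Basic

variable {V C : Type*}

/-- Reachability along edges. -/
def Reach (G : Signing V) : V → V → Prop := Relation.ReflTransGen fun x y => G x y ≠ 0

open Classical in
/-- Remove all edges meeting `R`. -/
noncomputable def delete (G : Signing V) (R : Set V) : Signing V where
  sgn x y := if x ∈ R ∨ y ∈ R then 0 else G x y
  symm x y := by simp only [or_comm, G.symm x y]
  irrefl x := by simp [G.irrefl]

open Classical in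
/-- Give the pair `p, q` of distinct vertices the sign `a`. -/
noncomputable def setEdge (G : Signing V) (p q : V) (a : SignType) (h : p ≠ q) : Signing V where
  sgn x y := if (x = p ∧ y = q) ∨ (x = q ∧ y = p) then a else G x y
  symm x y := by
    rw [G.symm x y]
    congr 1
    simp only [eq_iff_iff]
    tauto
  irrefl x := by
    rw [if_neg, G.irrefl]
    rintro (⟨rfl, rfl⟩ | ⟨rfl, rfl⟩) <;> exact h rfl

theorem ne_of_adj (G : Signing V) {x y : V} (h : G x y ≠ 0) : x ≠ y := by
  rintro rfl
  exact h (G.irrefl x)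

theorem adj_symm (G : Signing V) {x y : V} (h : G x y ≠ 0) : G y x ≠ 0 := by rwa [G.symm]

theorem delete_apply (G : Signing V) {R : Set V} {x y : V} (hx : x ∉ R) (hy : y ∉ R) :
    G.delete R x y = G x y := by
  simp [delete, hx, hy]

theorem delete_adj (G : Signing V) {R : Set V} {x y : V} (h : G.delete R x y ≠ 0) :
    x ∉ R ∧ y ∉ R ∧ G.delete R x y = G x y := by
  have h' : ¬(x ∈ R ∨ y ∈ R) := fun hc => h (by simp [delete, hc])
  rw [not_or] at h'
  exact ⟨h'.1, h'.2, G.delete_apply h'.1 h'.2⟩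

theorem setEdge_same (G : Signing V) {p q : V} {a : SignType} (h : p ≠ q) :
    G.setEdge p q a h p q = a := by
  simp [setEdge]

theorem setEdge_of_ne (G : Signing V) {p q : V} {a : SignType} (h : p ≠ q) {x y : V}
    (hxy : ¬((x = p ∧ y = q) ∨ (x = q ∧ y = p))) : G.setEdge p q a h x y = G x y :=
  if_neg hxy

theorem setEdge_adj (G : Signing V) {p q : V} {a : SignType} (h : p ≠ q) (ha : a ≠ 0) {x y : V}
    (hxy : G x y ≠ 0) : G.setEdge p q a h x y ≠ 0 := by
  simp only [setEdge]
  split_ifs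
  · exact ha
  · exact hxy

/-- A colouring away from `R` extends once the edges at `R` are respected. -/
theorem IsColouring.extend {G : Signing V} {T : C → C → SignType} (hT : ∀ i j, T i j = T j i)
    {φ ψ : V → C} (R : Set V)
    (hφ : ∀ x y, x ∉ R → y ∉ R → G x y ≠ 0 → T (φ x) (φ y) = G x y)
    (hoff : ∀ x, x ∉ R → ψ x = φ x) (hR : ∀ r ∈ R, ∀ y, G r y ≠ 0 → T (ψ r) (ψ y) = G r y) :
    G.IsColouring T ψ := by
  intro x y hxy
  by_cases hx : x ∈ R
  · exact hR x hx y hxy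
  · by_cases hy : y ∈ R
    · rw [hT, G.symm]
      exact hR y hy x (G.adj_symm hxy)
    · rw [hoff x hx, hoff y hy]
      exact hφ x y hx hy hxy

theorem IsColouring.of_delete {G : Signing V} {T : C → C → SignType} {φ : V → C} {R : Set V}
    (hφ : (G.delete R).IsColouring T φ) (x y : V) (hx : x ∉ R) (hy : y ∉ R) (hxy : G x y ≠ 0) :
    T (φ x) (φ y) = G x y := by
  rw [← G.delete_apply hx hy] at hxy ⊢
  exact hφ x y hxy

/-- The vertices `d, p, q, r, s` carry a complete graph on four vertices `p, q, r, s` in sign `e`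
whose edge `pq` is subdivided by `d`, with different signs. -/
structure IsObstruction (G : Signing V) (e : SignType) (d p q r s : V) : Prop where
  sign_ne : e ≠ 0
  dp_ne : G d p ≠ 0
  dq : G d q = -G d p
  pr : G p r = e
  ps : G p s = e
  qr : G q r = e
  qs : G q s = e
  rs : G r s = e

/-- `G` contains no obstruction. -/
def Unobstructed (G : Signing V) : Prop := ∀ e d p q r s, ¬ G.IsObstruction e d p q r s

namespace IsObstruction

variable {G : Signing V} {e : SignType} {d p q r s : V}

theorem swap_ends (h : G.IsObstruction e d p q r s) : G.IsObstruction e d q p r s :=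
  ⟨h.sign_ne, h.dq ▸ sign_neg_ne_zero _ h.dp_ne, by rw [h.dq, sign_neg_neg], h.qr, h.qs, h.pr, h.ps, h.rs⟩

theorem swap_mids (h : G.IsObstruction e d p q r s) : G.IsObstruction e d p q s r :=
  ⟨h.sign_ne, h.dp_ne, h.dq, h.ps, h.pr, h.qs, h.qr, by rw [G.symm, h.rs]⟩

theorem pq_ne (h : G.IsObstruction e d p q r s) : p ≠ q := by
  rintro rfl
  exact sign_ne_neg _ h.dp_ne h.dq

/-- If `d` were `r`, both edges from `d` to `p` and `q` would have sign `e`, but their signs differ.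
-/
theorem dr_ne (h : G.IsObstruction e d p q r s) : d ≠ r := by
  rintro rfl
  have h1 := h.dq
  rw [G.symm d q, G.symm d p, h.qr, h.pr] at h1
  exact sign_ne_neg _ h.sign_ne h1

theorem ds_ne (h : G.IsObstruction e d p q r s) : d ≠ s := h.swap_mids.dr_ne

theorem dq_ne (h : G.IsObstruction e d p q r s) : G d q ≠ 0 := h.swap_ends.dp_ne

theorem pr_ne (h : G.IsObstruction e d p q r s) : G p r ≠ 0 := h.pr ▸ h.sign_ne
theorem ps_ne (h : G.IsObstruction e d p q r s) : G p s ≠ 0 := h.ps ▸ h.sign_ne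
theorem qr_ne (h : G.IsObstruction e d p q r s) : G q r ≠ 0 := h.qr ▸ h.sign_ne
theorem qs_ne (h : G.IsObstruction e d p q r s) : G q s ≠ 0 := h.qs ▸ h.sign_ne
theorem rs_ne (h : G.IsObstruction e d p q r s) : G r s ≠ 0 := h.rs ▸ h.sign_ne

end IsObstruction

/-- Agreement on the seven edges transports an obstruction. -/
theorem IsObstruction.transport {G H : Signing V} {e : SignType} {d p q r s : V}
    (h : G.IsObstruction e d p q r s) (h1 : H d p = G d p) (h2 : H d q = G d q)
    (h3 : H p r = G p r) (h4 : H p s = G p s) (h5 : H q r = G q r) (h6 : H q s = G q s)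
    (h7 : H r s = G r s) : H.IsObstruction e d p q r s :=
  ⟨h.sign_ne, h1 ▸ h.dp_ne, by rw [h1, h2, h.dq], h3 ▸ h.pr, h4 ▸ h.ps, h5 ▸ h.qr, h6 ▸ h.qs,
    h7 ▸ h.rs⟩

/-- Every edge of `G` is an edge of `H` of the same sign. -/
def Sub (G H : Signing V) : Prop := ∀ x y, G x y ≠ 0 → H x y = G x y

theorem delete_sub (G : Signing V) (R : Set V) : Sub (G.delete R) G :=
  fun _ _ h => (G.delete_adj h).2.2.symm

theorem Sub.adj {G H : Signing V} (h : Sub G H) {x y : V} (hxy : G x y ≠ 0) : H x y ≠ 0 := by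
  rwa [h x y hxy]

theorem Unobstructed.mono {G H : Signing V} (hH : H.Unobstructed) (h : Sub G H) :
    G.Unobstructed := fun e d p q r s ho =>
  hH e d p q r s (ho.transport (h _ _ ho.dp_ne) (h _ _ ho.dq_ne) (h _ _ ho.pr_ne) (h _ _ ho.ps_ne)
    (h _ _ ho.qr_ne) (h _ _ ho.qs_ne) (h _ _ ho.rs_ne))

theorem Reach.mono {G H : Signing V} (h : ∀ x y, G x y ≠ 0 → H x y ≠ 0) {x y : V}
    (hr : G.Reach x y) : H.Reach x y :=
  Relation.ReflTransGen.mono h _ _ hr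

end Basic

/-! ### Degrees and cubic components. -/

section Degree

variable {V : Type*} [Fintype V]

/-- The neighbours of a vertex. -/
def nbrs (G : Signing V) (x : V) : Finset V := Finset.univ.filter fun y => G x y ≠ 0

@[simp]
theorem mem_nbrs {G : Signing V} {x y : V} : y ∈ G.nbrs x ↔ G x y ≠ 0 := by simp [nbrs]

/-- All degrees are at most three. -/
def Subcubic (G : Signing V) : Prop := ∀ x, (G.nbrs x).card ≤ 3

/-- No component is cubic. -/
def Proper (G : Signing V) : Prop := ∀ x, ∃ y, G.Reach x y ∧ (G.nbrs y).card ≤ 2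

theorem nbrs_mono {G H : Signing V} (h : ∀ x y, G x y ≠ 0 → H x y ≠ 0) (x : V) :
    G.nbrs x ⊆ H.nbrs x := fun y hy => mem_nbrs.2 (h x y (mem_nbrs.1 hy))

theorem eq_of_three {G : Signing V} {r a b c : V} (hd : (G.nbrs r).card ≤ 3) (ha : G r a ≠ 0)
    (hb : G r b ≠ 0) (hc : G r c ≠ 0) (hab : a ≠ b) (hac : a ≠ c) (hbc : b ≠ c) (z : V)
    (hz : G r z ≠ 0) : z = a ∨ z = b ∨ z = c := by
  classical
  have hs : ({a, b, c} : Finset V) ⊆ G.nbrs r := by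
    intro y hy
    simp only [Finset.mem_insert, Finset.mem_singleton] at hy
    rcases hy with rfl | rfl | rfl <;> simpa
  have heq := Finset.eq_of_subset_of_card_le hs (by
    rw [Finset.card_eq_three.2 ⟨a, b, c, hab, hac, hbc, rfl⟩]; exact hd)
  have : z ∈ ({a, b, c} : Finset V) := heq ▸ mem_nbrs.2 hz
  simpa using this

theorem eq_of_two {G : Signing V} {r a b : V} (hd : (G.nbrs r).card ≤ 2) (ha : G r a ≠ 0)
    (hb : G r b ≠ 0) (hab : a ≠ b) (z : V) (hz : G r z ≠ 0) : z = a ∨ z = b := by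
  by_contra hcon
  rw [not_or] at hcon
  classical
  have hs : ({a, b, z} : Finset V) ⊆ G.nbrs r := by
    intro y hy
    simp only [Finset.mem_insert, Finset.mem_singleton] at hy
    rcases hy with rfl | rfl | rfl <;> simpa
  have := Finset.card_le_card hs
  rw [Finset.card_eq_three.2 ⟨a, b, z, hab, Ne.symm hcon.1, Ne.symm hcon.2, rfl⟩] at this
  omega

theorem three_le_card {G : Signing V} {r a b c : V} (ha : G r a ≠ 0)
    (hb : G r b ≠ 0) (hc : G r c ≠ 0) (hab : a ≠ b) (hac : a ≠ c) (hbc : b ≠ c) :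
    ¬ (G.nbrs r).card ≤ 2 := by
  intro h
  rcases eq_of_two h ha hb hab c hc with rfl | rfl
  · exact hac rfl
  · exact hbc rfl

theorem Subcubic.mono {G H : Signing V} (hH : H.Subcubic) (h : Sub G H) : G.Subcubic := fun x =>
  (Finset.card_le_card (nbrs_mono (fun _ _ => h.adj) x)).trans (hH x)

/-- Passing to a subgraph of a subcubic graph keeps every component off cubic, as long as each
component of the large graph meets a vertex of degree at most two in the subgraph. -/
theorem proper_of_reach {G H : Signing V} (hH : H.Subcubic) (h : ∀ x y, G x y ≠ 0 → H x y ≠ 0)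
    (hr : ∀ x, ∃ y, H.Reach x y ∧ (G.nbrs y).card ≤ 2) : G.Proper := by
  intro x
  obtain ⟨y, hxy, hy⟩ := hr x
  induction hxy using Relation.ReflTransGen.head_induction_on with
  | refl => exact ⟨y, Relation.ReflTransGen.refl, hy⟩
  | @head x z h1 _ ih =>
    -- The first edge of the walk that is missing in `G` starts at a vertex that has lost degree,
    -- which then serves as the witness.
    by_cases hxz : G x z = 0
    · refine ⟨x, Relation.ReflTransGen.refl, ?_⟩
      have : (G.nbrs x).card < (H.nbrs x).card := by
        refine Finset.card_lt_card ⟨nbrs_mono h x, fun hs => ?_⟩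
        exact mem_nbrs.1 (hs (mem_nbrs.2 h1)) hxz
      have := hH x
      omega
    · obtain ⟨t, ht, ht2⟩ := ih
      exact ⟨t, Relation.ReflTransGen.head hxz ht, ht2⟩

theorem Proper.mono {G H : Signing V} (hH : H.Subcubic) (hp : H.Proper) (h : Sub G H) :
    G.Proper := by
  refine proper_of_reach hH (fun _ _ => h.adj) fun x => ?_
  obtain ⟨y, hxy, hy⟩ := hp x
  exact ⟨y, hxy, (Finset.card_le_card (nbrs_mono (fun _ _ => h.adj) y)).trans hy⟩

theorem nbrs_setEdge_of_ne (G : Signing V) {p q : V} {a : SignType} (h : p ≠ q) {x : V}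
    (hp : x ≠ p) (hq : x ≠ q) : (G.setEdge p q a h).nbrs x = G.nbrs x := by
  ext y
  rw [mem_nbrs, mem_nbrs, setEdge_of_ne]
  tauto

theorem card_nbrs_setEdge_le (G : Signing V) {p q : V} {a : SignType} (h : p ≠ q) (x : V) :
    ((G.setEdge p q a h).nbrs x).card ≤ (G.nbrs x).card + 1 := by
  classical
  by_cases hp : x = p
  · refine (Finset.card_le_card (t := insert q (G.nbrs x)) fun y hy => ?_).trans
      (Finset.card_insert_le _ _)
    rw [Finset.mem_insert, mem_nbrs]
    by_contra hc
    rw [not_or] at hc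
    rw [mem_nbrs, setEdge_of_ne] at hy
    · exact hc.2 hy
    · rintro (⟨-, rfl⟩ | ⟨rfl, rfl⟩)
      · exact hc.1 rfl
      · exact h hp.symm
  · by_cases hq : x = q
    · refine (Finset.card_le_card (t := insert p (G.nbrs x)) fun y hy => ?_).trans
        (Finset.card_insert_le _ _)
      rw [Finset.mem_insert, mem_nbrs]
      by_contra hc
      rw [not_or] at hc
      rw [mem_nbrs, setEdge_of_ne] at hy
      · exact hc.2 hy
      · rintro (⟨rfl, rfl⟩ | ⟨-, rfl⟩)
        · exact hp rfl
        · exact hc.1 rfl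
    · rw [nbrs_setEdge_of_ne G h hp hq]
      omega

theorem card_nbrs_delete_lt (G : Signing V) {R : Set V} {x r : V} (hr : r ∈ R) (hxr : G x r ≠ 0) :
    ((G.delete R).nbrs x).card < (G.nbrs x).card := by
  refine Finset.card_lt_card ⟨nbrs_mono (fun _ _ => (G.delete_sub R).adj) x, fun hs => ?_⟩
  exact (G.delete_adj (mem_nbrs.1 (hs (mem_nbrs.2 hxr)))).2.1 hr

theorem card_nbrs_delete_of_mem (G : Signing V) {R : Set V} {r : V} (hr : r ∈ R) :
    ((G.delete R).nbrs r).card = 0 := by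
  rw [Finset.card_eq_zero, Finset.eq_empty_iff_forall_notMem]
  intro y hy
  exact (G.delete_adj (mem_nbrs.1 hy)).1 hr

/-- Only `p` and `q` gain degree, and they now share a component, so a single witness reachable from
`p` repairs every walk that used to end at one of them. -/
theorem proper_setEdge {G : Signing V} {p q : V} {a : SignType} (h : p ≠ q) (ha : a ≠ 0)
    (hG : G.Proper)
    (hz : ∃ z, (G.setEdge p q a h).Reach p z ∧ ((G.setEdge p q a h).nbrs z).card ≤ 2) :
    (G.setEdge p q a h).Proper := by
  intro x
  obtain ⟨y, hxy, hy⟩ := hG x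
  have hxy' := hxy.mono fun _ _ => G.setEdge_adj (p := p) (q := q) h ha
  by_cases hp : y = p
  · obtain ⟨z, h1, h2⟩ := hz
    exact ⟨z, hxy'.trans (hp ▸ h1), h2⟩
  · by_cases hq : y = q
    · obtain ⟨z, h1, h2⟩ := hz
      refine ⟨z, hxy'.trans (Relation.ReflTransGen.head ?_ h1), h2⟩
      rw [hq, symm, setEdge_same]
      exact ha
    · exact ⟨y, hxy', by rwa [nbrs_setEdge_of_ne G h hp hq]⟩

end Degree


/-! ### Recolouring finitely many vertices. -/

section Update

theorem exists_update {V C : Type*} (φ : V → C) (l : List (V × C)) (hl : (l.map Prod.fst).Nodup) :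
    ∃ ψ : V → C, (∀ p ∈ l, ψ p.1 = p.2) ∧ ∀ z, z ∉ l.map Prod.fst → ψ z = φ z := by
  classical
  induction l with
  | nil => exact ⟨φ, by simp, by simp⟩
  | cons a l ih =>
    rw [List.map_cons, List.nodup_cons] at hl
    obtain ⟨ψ, h1, h2⟩ := ih hl.2
    refine ⟨Function.update ψ a.1 a.2, ?_, ?_⟩
    · intro p hp
      rcases List.mem_cons.1 hp with rfl | hp
      · simp
      · rw [Function.update_of_ne, h1 p hp]
        rintro h
        exact hl.1 (h ▸ List.mem_map_of_mem hp)
    · intro z hz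
      rw [List.map_cons, List.mem_cons, not_or] at hz
      rw [Function.update_of_ne hz.1, h2 z hz.2]

/-- Recolour the vertices of a list, with prescribed colours. -/
theorem IsColouring.patch {V C : Type*} {G : Signing V} {T : C → C → SignType}
    (hT : ∀ i j, T i j = T j i) {φ : V → C} (l : List (V × C))
    (hφ : ∀ x y, x ∉ l.map Prod.fst → y ∉ l.map Prod.fst → G x y ≠ 0 → T (φ x) (φ y) = G x y)
    (hl : (l.map Prod.fst).Nodup)
    (hR : ∀ ψ : V → C, (∀ p ∈ l, ψ p.1 = p.2) → (∀ z, z ∉ l.map Prod.fst → ψ z = φ z) →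
      ∀ p ∈ l, ∀ y, G p.1 y ≠ 0 → T p.2 (ψ y) = G p.1 y) :
    ∃ ψ : V → C, G.IsColouring T ψ ∧ (∀ p ∈ l, ψ p.1 = p.2) ∧
      ∀ z, z ∉ l.map Prod.fst → ψ z = φ z := by
  obtain ⟨ψ, h1, h2⟩ := exists_update φ l hl
  refine ⟨ψ, IsColouring.extend hT {z | z ∈ l.map Prod.fst} hφ h2 ?_, h1, h2⟩
  intro r hr y hy
  obtain ⟨p, hp, rfl⟩ := List.mem_map.1 hr
  rw [h1 p hp]
  exact hR ψ h1 h2 p hp y hy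

end Update

theorem IsColouring.sign_eq {V C : Type*} {G : Signing V} {T : C → C → SignType} {φ : V → C}
    (hφ : G.IsColouring T φ) {u x y : V} (hx : G u x ≠ 0) (hy : G u y ≠ 0) (h : φ x = φ y) :
    G u x = G u y := by
  rw [← hφ u x hx, ← hφ u y hy, h]

variable {V : Type*}

/-- Separate a union of components from the rest by a translation. -/
theorem IsColouring.separate {G : Signing V} {φ : V → Fin 9} (hφ : G.IsColouring rook φ)
    {K : V → Prop} (hK : ∀ x y, K x → G x y ≠ 0 → K y) {u w : V} (hu : K u) (hw : ¬ K w) :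
    ∃ ψ, G.IsColouring rook ψ ∧ ψ u ≠ ψ w := by
  classical
  by_cases h : φ u = φ w
  · refine ⟨fun z => if K z then rookShift (φ z) else φ z, ?_, ?_⟩
    · intro x y hxy
      have : K x ↔ K y := ⟨fun h => hK x y h hxy, fun h => hK y x h (G.adj_symm hxy)⟩
      by_cases hx : K x
      · simp only [hx, this.1 hx, if_true, rookShift_rook]
        exact hφ x y hxy
      · have hy : ¬ K y := fun h => hx (this.2 h)
        simp only [hx, hy, if_false]
        exact hφ x y hxy
    · simp only [hu, hw, if_true, if_false, h]
      exact rookShift_ne _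
  · exact ⟨φ, hφ, h⟩

variable [Fintype V]

/-- A vertex of degree at most two can be recoloured away from a forbidden colour unless its two
edges have the sign of the pair of colours at their ends. -/
theorem IsColouring.recolour {G : Signing V} {φ : V → Fin 9} {u : V}
    (hφ : ∀ x y, x ≠ u → y ≠ u → G x y ≠ 0 → rook (φ x) (φ y) = G x y)
    (hd : (G.nbrs u).card ≤ 2)
    (h : ∀ x y, G u x ≠ 0 → G u y ≠ 0 → φ x = φ y → G u x = G u y)
    (h' : ∀ x y, G u x ≠ 0 → G u y ≠ 0 → x ≠ y → G u x = G u y → rook (φ x) (φ y) ≠ G u x)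
    (f : Fin 9) :
    ∃ ψ, G.IsColouring rook ψ ∧ ψ u ≠ f ∧ ∀ z, z ≠ u → ψ z = φ z := by
  classical
  suffices hc : ∃ c, c ≠ f ∧ ∀ z, G u z ≠ 0 → rook c (φ z) = G u z by
    obtain ⟨c, hcf, hc⟩ := hc
    obtain ⟨ψ, h1, h2, h3⟩ := IsColouring.patch (G := G) rook_symm (φ := φ) [(u, c)]
      (by simpa using hφ) (by simp) (by
        intro ψ h2 h3
        simp only [List.mem_singleton, forall_eq, List.map_cons, List.map_nil] at h2 h3 ⊢
        intro y hy
        rw [h3 y (G.ne_of_adj hy).symm]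
        exact hc y hy)
    simp only [List.mem_singleton, forall_eq, List.map_cons, List.map_nil] at h2 h3
    exact ⟨ψ, h1, h2 ▸ hcf, h3⟩
  have h012 : (G.nbrs u).card = 0 ∨ (G.nbrs u).card = 1 ∨ (G.nbrs u).card = 2 := by omega
  have hmem : ∀ z, G u z ≠ 0 ↔ z ∈ G.nbrs u := fun z => mem_nbrs.symm
  rcases h012 with h0 | h1 | h2
  · rw [Finset.card_eq_zero] at h0
    refine ⟨rookShift f, rookShift_ne f, fun z hz => ?_⟩
    rw [hmem, h0] at hz
    simp at hz
  · obtain ⟨p, hp⟩ := Finset.card_eq_one.1 h1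
    have hup : G u p ≠ 0 := by rw [hmem, hp]; simp
    obtain ⟨c, hcf, hc⟩ := rook_extend_one (φ p) f _ hup
    refine ⟨c, hcf, fun z hz => ?_⟩
    rw [hmem, hp, Finset.mem_singleton] at hz
    rw [hz, hc]
  · obtain ⟨p, q, hpq, hp⟩ := Finset.card_eq_two.1 h2
    have hup : G u p ≠ 0 := by rw [hmem, hp]; simp
    have huq : G u q ≠ 0 := by rw [hmem, hp]; simp
    obtain ⟨c, hcf, hc1, hc2⟩ := rook_extend_two (φ p) (φ q) _ _ f hup huq (h p q hup huq)
      (fun he => h' p q hup huq hpq he)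
    refine ⟨c, hcf, fun z hz => ?_⟩
    rw [hmem, hp, Finset.mem_insert, Finset.mem_singleton] at hz
    rcases hz with rfl | rfl
    · exact hc1
    · exact hc2

/-! ### Recolouring an obstruction in which `u` subdivides an edge. -/

section Split

variable {H : Signing V} {φ : V → Fin 9} {u d p q r s : V} {a b : SignType}

/-- Here `u` replaces the edge `dp`. All neighbours of the recoloured vertices lie among them and
`d`, so only the colour of `d` matters. The edges from `p` and `q` to the outside are now
compatible, and both vertices can take the colour `k`. -/
theorem recolour_split_mid (hφ : H.IsColouring rook φ) (hH : H.Subcubic)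
    (hu : (H.nbrs u).card ≤ 2) (ha : a ≠ 0) (hb : b ≠ 0)
    (hud : H u d = a) (hup : H u p = a) (hdq : H d q = a) (hpr : H p r = b) (hps : H p s = b)
    (hqr : H q r = b) (hqs : H q s = b) (hrs : H r s = b) (hdp : d ≠ p)
    (hpq : p ≠ q) (hdr : d ≠ r) (hds : d ≠ s) (huq : u ≠ q) (hur : u ≠ r) (hus : u ≠ s)
    (f : Fin 9) : ∃ ψ, H.IsColouring rook ψ ∧ ψ u ≠ f ∧
      ∀ z, z ≠ u → z ≠ p → z ≠ q → z ≠ r → z ≠ s → ψ z = φ z := by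
  obtain ⟨k, hk, c, hcf, hcd, hck, m, hm, n, hn, hmn⟩ := rook_split_mid (φ d) f a b ha hb
  have nud := H.ne_of_adj (hud ▸ ha)
  have nup := H.ne_of_adj (hup ▸ ha)
  have ndq := H.ne_of_adj (hdq ▸ ha)
  have npr := H.ne_of_adj (hpr ▸ hb)
  have nps := H.ne_of_adj (hps ▸ hb)
  have nqr := H.ne_of_adj (hqr ▸ hb)
  have nqs := H.ne_of_adj (hqs ▸ hb)
  have nrs := H.ne_of_adj (hrs ▸ hb)
  have hpu := H.symm u p ▸ hup
  have hqd := H.symm d q ▸ hdq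
  have hrp := H.symm p r ▸ hpr
  have hsp := H.symm p s ▸ hps
  have hrq := H.symm q r ▸ hqr
  have hsq := H.symm q s ▸ hqs
  have hsr := H.symm r s ▸ hrs
  have eu := eq_of_two hu (hud ▸ ha) (hup ▸ ha) hdp
  have ep := eq_of_three (hH p) (hpu ▸ ha) (hpr ▸ hb) (hps ▸ hb) hur hus nrs
  have eq := eq_of_three (hH q) (hqd ▸ ha) (hqr ▸ hb) (hqs ▸ hb) hdr hds nrs
  have er := eq_of_three (hH r) (hrp ▸ hb) (hrq ▸ hb) (hrs ▸ hb) hpq nps nqs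
  have es := eq_of_three (hH s) (hsp ▸ hb) (hsq ▸ hb) (hsr ▸ hb) hpq npr nqr
  obtain ⟨ψ, h1, h2, h3⟩ := IsColouring.patch (G := H) rook_symm (φ := φ)
    [(u, c), (p, k), (q, k), (r, m), (s, n)] (fun x y _ _ h => hφ x y h)
    (by simp [*]) (by
      intro ψ h2 h3
      simp only [List.mem_cons, List.not_mem_nil, or_false, forall_eq_or_imp, forall_eq,
        List.map_cons, List.map_nil, not_or, and_imp] at h2 h3 ⊢
      obtain ⟨vu, vp, vq, vr, vs⟩ := h2
      have vd := h3 d nud.symm hdp ndq hdr hds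
      refine ⟨?_, ?_, ?_, ?_, ?_⟩
      · intro y hy
        rcases eu y hy with rfl | rfl
        · rw [vd, hcd, hud]
        · rw [vp, hck, hup]
      · intro y hy
        rcases ep y hy with rfl | rfl | rfl
        · rw [vu, rook_symm, hck, hpu]
        · rw [vr, hm, hpr]
        · rw [vs, hn, hps]
      · intro y hy
        rcases eq y hy with rfl | rfl | rfl
        · rw [vd, rook_symm, hk, hqd]
        · rw [vr, hm, hqr]
        · rw [vs, hn, hqs]
      · intro y hy
        rcases er y hy with rfl | rfl | rfl
        · rw [vp, rook_symm, hm, hrp]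
        · rw [vq, rook_symm, hm, hrq]
        · rw [vs, hmn, hrs]
      · intro y hy
        rcases es y hy with rfl | rfl | rfl
        · rw [vp, rook_symm, hn, hsp]
        · rw [vq, rook_symm, hn, hsq]
        · rw [vr, rook_symm, hmn, hsr])
  simp only [List.mem_cons, List.not_mem_nil, or_false, forall_eq_or_imp, forall_eq,
    List.map_cons, List.map_nil, not_or, and_imp] at h2 h3
  exact ⟨ψ, h1, h2.1 ▸ hcf, h3⟩

/-- Here `u` replaces the edge `pr` of the K4. With that edge gone, `p` and `q` can take different
colours, as `d` demands; again only the colour of `d` is kept. -/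
theorem recolour_split_side (hφ : H.IsColouring rook φ) (hH : H.Subcubic)
    (hu : (H.nbrs u).card ≤ 2) (ha : a ≠ 0) (hb : b ≠ 0)
    (hup : H u p = a) (hur : H u r = a) (hdp : H d p = b) (hdq : H d q = -b) (hps : H p s = -a)
    (hqr : H q r = -a) (hqs : H q s = -a) (hrs : H r s = -a) (npr : p ≠ r)
    (hpq : p ≠ q) (hdr : d ≠ r) (hds : d ≠ s) (hud : u ≠ d) (huq : u ≠ q) (hus : u ≠ s)
    (f : Fin 9) : ∃ ψ, H.IsColouring rook ψ ∧ ψ u ≠ f ∧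
      ∀ z, z ≠ u → z ≠ p → z ≠ q → z ≠ r → z ≠ s → ψ z = φ z := by
  obtain ⟨k, hk, l, hl, m, hlm, n, hkn, hln, hmn, c, hcf, hck, hcm⟩ :=
    rook_split_side (φ d) f a b ha hb
  have ha' := sign_neg_ne_zero a ha
  have hb' := sign_neg_ne_zero b hb
  have nup := H.ne_of_adj (hup ▸ ha)
  have nur := H.ne_of_adj (hur ▸ ha)
  have ndp := H.ne_of_adj (hdp ▸ hb)
  have ndq := H.ne_of_adj (hdq ▸ hb')
  have nps := H.ne_of_adj (hps ▸ ha')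
  have nqr := H.ne_of_adj (hqr ▸ ha')
  have nqs := H.ne_of_adj (hqs ▸ ha')
  have nrs := H.ne_of_adj (hrs ▸ ha')
  have hpu := H.symm u p ▸ hup
  have hru := H.symm u r ▸ hur
  have hpd := H.symm d p ▸ hdp
  have hqd := H.symm d q ▸ hdq
  have hsp := H.symm p s ▸ hps
  have hrq := H.symm q r ▸ hqr
  have hsq := H.symm q s ▸ hqs
  have hsr := H.symm r s ▸ hrs
  have eu := eq_of_two hu (hup ▸ ha) (hur ▸ ha) npr
  have ep := eq_of_three (hH p) (hpu ▸ ha) (hpd ▸ hb) (hps ▸ ha') hud hus hds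
  have eq := eq_of_three (hH q) (hqd ▸ hb') (hqr ▸ ha') (hqs ▸ ha') hdr hds nrs
  have er := eq_of_three (hH r) (hru ▸ ha) (hrq ▸ ha') (hrs ▸ ha') huq hus nqs
  have es := eq_of_three (hH s) (hsp ▸ ha') (hsq ▸ ha') (hsr ▸ ha') hpq npr nqr
  obtain ⟨ψ, h1, h2, h3⟩ := IsColouring.patch (G := H) rook_symm (φ := φ)
    [(u, c), (p, k), (q, l), (r, m), (s, n)] (fun x y _ _ h => hφ x y h)
    (by simp [*]) (by
      intro ψ h2 h3
      simp only [List.mem_cons, List.not_mem_nil, or_false, forall_eq_or_imp, forall_eq,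
        List.map_cons, List.map_nil, not_or, and_imp] at h2 h3 ⊢
      obtain ⟨vu, vp, vq, vr, vs⟩ := h2
      have vd := h3 d hud.symm ndp ndq hdr hds
      refine ⟨?_, ?_, ?_, ?_, ?_⟩
      · intro y hy
        rcases eu y hy with rfl | rfl
        · rw [vp, hck, hup]
        · rw [vr, hcm, hur]
      · intro y hy
        rcases ep y hy with rfl | rfl | rfl
        · rw [vu, rook_symm, hck, hpu]
        · rw [vd, rook_symm, hk, hpd]
        · rw [vs, hkn, hps]
      · intro y hy
        rcases eq y hy with rfl | rfl | rfl
        · rw [vd, rook_symm, hl, hqd]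
        · rw [vr, hlm, hqr]
        · rw [vs, hln, hqs]
      · intro y hy
        rcases er y hy with rfl | rfl | rfl
        · rw [vu, rook_symm, hcm, hru]
        · rw [vq, rook_symm, hlm, hrq]
        · rw [vs, hmn, hrs]
      · intro y hy
        rcases es y hy with rfl | rfl | rfl
        · rw [vp, rook_symm, hkn, hsp]
        · rw [vq, rook_symm, hln, hsq]
        · rw [vr, rook_symm, hmn, hsr])
  simp only [List.mem_cons, List.not_mem_nil, or_false, forall_eq_or_imp, forall_eq,
    List.map_cons, List.map_nil, not_or, and_imp] at h2 h3
  exact ⟨ψ, h1, h2.1 ▸ hcf, h3⟩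

/-- Here `u` replaces the edge `rs`. Then `r` and `s` may form a pair of sign other than `-a`, so
their common neighbours `p` and `q` are no longer forced to agree. -/
theorem recolour_split_rung (hφ : H.IsColouring rook φ) (hH : H.Subcubic)
    (hu : (H.nbrs u).card ≤ 2) (ha : a ≠ 0) (hb : b ≠ 0)
    (hur : H u r = a) (hus : H u s = a) (hdp : H d p = b) (hdq : H d q = -b) (hpr : H p r = -a)
    (hps : H p s = -a) (hqr : H q r = -a) (hqs : H q s = -a) (nrs : r ≠ s)
    (hpq : p ≠ q) (hdr : d ≠ r) (hds : d ≠ s) (hud : u ≠ d) (hup : u ≠ p) (huq : u ≠ q)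
    (f : Fin 9) : ∃ ψ, H.IsColouring rook ψ ∧ ψ u ≠ f ∧
      ∀ z, z ≠ u → z ≠ p → z ≠ q → z ≠ r → z ≠ s → ψ z = φ z := by
  obtain ⟨k, hk, l, hl, m, hkm, hlm, n, hkn, hln, c, hcf, hcm, hcn⟩ :=
    rook_split_rung (φ d) f a b ha hb
  have ha' := sign_neg_ne_zero a ha
  have hb' := sign_neg_ne_zero b hb
  have nur := H.ne_of_adj (hur ▸ ha)
  have nus := H.ne_of_adj (hus ▸ ha)
  have ndp := H.ne_of_adj (hdp ▸ hb)
  have ndq := H.ne_of_adj (hdq ▸ hb')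
  have npr := H.ne_of_adj (hpr ▸ ha')
  have nps := H.ne_of_adj (hps ▸ ha')
  have nqr := H.ne_of_adj (hqr ▸ ha')
  have nqs := H.ne_of_adj (hqs ▸ ha')
  have hsu := H.symm u s ▸ hus
  have hru := H.symm u r ▸ hur
  have hpd := H.symm d p ▸ hdp
  have hqd := H.symm d q ▸ hdq
  have hrp := H.symm p r ▸ hpr
  have hsp := H.symm p s ▸ hps
  have hrq := H.symm q r ▸ hqr
  have hsq := H.symm q s ▸ hqs
  have eu := eq_of_two hu (hur ▸ ha) (hus ▸ ha) nrs
  have ep := eq_of_three (hH p) (hpd ▸ hb) (hpr ▸ ha') (hps ▸ ha') hdr hds nrs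
  have eq := eq_of_three (hH q) (hqd ▸ hb') (hqr ▸ ha') (hqs ▸ ha') hdr hds nrs
  have er := eq_of_three (hH r) (hru ▸ ha) (hrp ▸ ha') (hrq ▸ ha') hup huq hpq
  have es := eq_of_three (hH s) (hsu ▸ ha) (hsp ▸ ha') (hsq ▸ ha') hup huq hpq
  obtain ⟨ψ, h1, h2, h3⟩ := IsColouring.patch (G := H) rook_symm (φ := φ)
    [(u, c), (p, k), (q, l), (r, m), (s, n)] (fun x y _ _ h => hφ x y h)
    (by simp [*]) (by
      intro ψ h2 h3
      simp only [List.mem_cons, List.not_mem_nil, or_false, forall_eq_or_imp, forall_eq,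
        List.map_cons, List.map_nil, not_or, and_imp] at h2 h3 ⊢
      obtain ⟨vu, vp, vq, vr, vs⟩ := h2
      have vd := h3 d hud.symm ndp ndq hdr hds
      refine ⟨?_, ?_, ?_, ?_, ?_⟩
      · intro y hy
        rcases eu y hy with rfl | rfl
        · rw [vr, hcm, hur]
        · rw [vs, hcn, hus]
      · intro y hy
        rcases ep y hy with rfl | rfl | rfl
        · rw [vd, rook_symm, hk, hpd]
        · rw [vr, hkm, hpr]
        · rw [vs, hkn, hps]
      · intro y hy
        rcases eq y hy with rfl | rfl | rfl
        · rw [vd, rook_symm, hl, hqd]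
        · rw [vr, hlm, hqr]
        · rw [vs, hln, hqs]
      · intro y hy
        rcases er y hy with rfl | rfl | rfl
        · rw [vu, rook_symm, hcm, hru]
        · rw [vp, rook_symm, hkm, hrp]
        · rw [vq, rook_symm, hlm, hrq]
      · intro y hy
        rcases es y hy with rfl | rfl | rfl
        · rw [vu, rook_symm, hcn, hsu]
        · rw [vp, rook_symm, hkn, hsp]
        · rw [vq, rook_symm, hln, hsq])
  simp only [List.mem_cons, List.not_mem_nil, or_false, forall_eq_or_imp, forall_eq,
    List.map_cons, List.map_nil, not_or, and_imp] at h2 h3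
  exact ⟨ψ, h1, h2.1 ▸ hcf, h3⟩

end Split


variable {V : Type*} [Fintype V]

/-! ### Separating `u` from `w` when the neighbours of `u` are nonadjacent. -/

section Nonadjacent

variable {H : Signing V} {φ : V → Fin 9} {u x y : V} {a : SignType}

/-- If joining the ends `x, y` of the two edges at `u` creates an obstruction, then `u` can be
recoloured, together with vertices of degree three. -/
theorem recolour_of_obstruction (hφ : H.IsColouring rook φ) (hH : H.Subcubic)
    (hU : H.Unobstructed) (hu : (H.nbrs u).card ≤ 2) (ha : a ≠ 0) (hxy : x ≠ y)
    (hux : H u x = a) (huy : H u y = a) (h0 : H x y = 0) {e : SignType} {d p q r s : V}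
    (ho : ((H.delete {u}).setEdge x y (-a) hxy).IsObstruction e d p q r s) (f : Fin 9) :
    ∃ ψ, H.IsColouring rook ψ ∧ ψ u ≠ f ∧ ∀ z, z ≠ u → (H.nbrs z).card ≤ 2 → ψ z = φ z := by
  have nux := H.ne_of_adj (hux ▸ ha)
  have nuy := H.ne_of_adj (huy ▸ ha)
  set G := (H.delete {u}).setEdge x y (-a) hxy with hG
  let M : V → V → Prop := fun i j => (i = x ∧ j = y) ∨ (i = y ∧ j = x)
  have hM : ∀ i j, M i j → G i j = -a ∧ H u i = a ∧ H u j = a ∧ H i j = 0 ∧ i ≠ j := by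
    rintro i j (⟨rfl, rfl⟩ | ⟨rfl, rfl⟩)
    · exact ⟨setEdge_same _ _, hux, huy, h0, hxy⟩
    · exact ⟨by rw [G.symm]; exact setEdge_same _ _, huy, hux, by rw [H.symm]; exact h0, hxy.symm⟩
  have hN : ∀ i j, ¬ M i j → G i j ≠ 0 → i ≠ u ∧ j ≠ u ∧ H i j = G i j := by
    intro i j hij hne
    have h1 : G i j = H.delete {u} i j := setEdge_of_ne _ _ hij
    rw [h1] at hne ⊢
    obtain ⟨h2, h3, h4⟩ := H.delete_adj hne
    exact ⟨h2, h3, h4.symm⟩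
  have hne : ∀ i j, G i j ≠ 0 → i ≠ u := by
    intro i j hij
    by_cases h : M i j
    · rcases h with ⟨rfl, -⟩ | ⟨rfl, -⟩
      · exact nux.symm
      · exact nuy.symm
    · exact (hN i j h hij).1
  -- the three positions of the new edge up to symmetry
  have key : ∀ {p q r s}, G.IsObstruction e d p q r s → M d p ∨ M p r ∨ M r s →
      ∃ ψ, H.IsColouring rook ψ ∧ ψ u ≠ f ∧ ∀ z, z ≠ u → (H.nbrs z).card ≤ 2 → ψ z = φ z := by
    intro p q r s ho hm
    have npq := ho.pq_ne
    have ndr := ho.dr_ne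
    have nds := ho.ds_ne
    have ndp := G.ne_of_adj ho.dp_ne
    have ndq := G.ne_of_adj ho.dq_ne
    have npr := G.ne_of_adj ho.pr_ne
    have nps := G.ne_of_adj ho.ps_ne
    have nqr := G.ne_of_adj ho.qr_ne
    have nqs := G.ne_of_adj ho.qs_ne
    have nrs := G.ne_of_adj ho.rs_ne
    have nud := (hne _ _ ho.dp_ne).symm
    have nup := (hne _ _ ho.pr_ne).symm
    have nuq := (hne _ _ ho.qr_ne).symm
    have nur := (hne _ _ ho.rs_ne).symm
    have nus := (hne _ _ (G.adj_symm ho.rs_ne)).symm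
    have fin : ∀ ψ : V → Fin 9, (∀ z, z ≠ u → z ≠ p → z ≠ q → z ≠ r → z ≠ s → ψ z = φ z) →
        (∀ z, z = p ∨ z = q ∨ z = r ∨ z = s → ¬ (H.nbrs z).card ≤ 2) →
        ∀ z, z ≠ u → (H.nbrs z).card ≤ 2 → ψ z = φ z := by
      intro ψ h1 h2 z hz hz2
      have h3 : ¬(z = p ∨ z = q ∨ z = r ∨ z = s) := fun h => h2 z h hz2
      simp only [not_or] at h3
      exact h1 z hz h3.1 h3.2.1 h3.2.2.1 h3.2.2.2
    rcases hm with hm | hm | hm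
    · obtain ⟨hv, hud, hup, h0', -⟩ := hM _ _ hm
      obtain ⟨-, -, hdq⟩ := hN d q (by grind) ho.dq_ne
      obtain ⟨-, -, hpr⟩ := hN p r (by grind) ho.pr_ne
      obtain ⟨-, -, hps⟩ := hN p s (by grind) ho.ps_ne
      obtain ⟨-, -, hqr⟩ := hN q r (by grind) ho.qr_ne
      obtain ⟨-, -, hqs⟩ := hN q s (by grind) ho.qs_ne
      obtain ⟨-, -, hrs⟩ := hN r s (by grind) ho.rs_ne
      -- The new edge `dp` has sign `-a`, so `dq` has sign `a`, the sign of both edges at `u`.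
      rw [ho.dq, hv, sign_neg_neg] at hdq
      rw [ho.pr] at hpr
      rw [ho.ps] at hps
      rw [ho.qr] at hqr
      rw [ho.qs] at hqs
      rw [ho.rs] at hrs
      have he := ho.sign_ne
      obtain ⟨ψ, h1, h2, h3⟩ := recolour_split_mid hφ hH hu ha he hud hup hdq hpr hps hqr hqs hrs
        ndp npq ndr nds nuq nur nus f
      refine ⟨ψ, h1, h2, fin ψ h3 ?_⟩
      rintro z (rfl | rfl | rfl | rfl)
      · exact three_le_card (H.adj_symm (hup ▸ ha)) (hpr ▸ he) (hps ▸ he) nur nus nrs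
      · exact three_le_card (H.adj_symm (hdq ▸ ha)) (hqr ▸ he) (hqs ▸ he) ndr nds nrs
      · exact three_le_card (H.adj_symm (hpr ▸ he)) (H.adj_symm (hqr ▸ he)) (hrs ▸ he) npq nps nqs
      · exact three_le_card (H.adj_symm (hps ▸ he)) (H.adj_symm (hqs ▸ he))
          (H.adj_symm (hrs ▸ he)) npq npr nqr
    · obtain ⟨hv, hup, hur, h0', -⟩ := hM _ _ hm
      obtain ⟨-, -, hdp⟩ := hN d p (by grind) ho.dp_ne
      obtain ⟨-, -, hdq⟩ := hN d q (by grind) ho.dq_ne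
      obtain ⟨-, -, hps⟩ := hN p s (by grind) ho.ps_ne
      obtain ⟨-, -, hqr⟩ := hN q r (by grind) ho.qr_ne
      obtain ⟨-, -, hqs⟩ := hN q s (by grind) ho.qs_ne
      obtain ⟨-, -, hrs⟩ := hN r s (by grind) ho.rs_ne
      -- The new edge belongs to the monochromatic K4, so its sign determines that of the K4.
      have he : e = -a := by rw [← ho.pr, hv]
      rw [ho.dq] at hdq
      rw [ho.ps, he] at hps
      rw [ho.qr, he] at hqr
      rw [ho.qs, he] at hqs
      rw [ho.rs, he] at hrs
      have hb := ho.dp_ne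
      have hb' := sign_neg_ne_zero _ hb
      have ha' := sign_neg_ne_zero _ ha
      obtain ⟨ψ, h1, h2, h3⟩ := recolour_split_side hφ hH hu ha hb hup hur hdp hdq hps hqr
        hqs hrs npr npq ndr nds nud nuq nus f
      refine ⟨ψ, h1, h2, fin ψ h3 ?_⟩
      rintro z (rfl | rfl | rfl | rfl)
      · exact three_le_card (H.adj_symm (hup ▸ ha)) (H.adj_symm (hdp ▸ hb)) (hps ▸ ha') nud nus nds
      · exact three_le_card (H.adj_symm (hdq ▸ hb')) (hqr ▸ ha') (hqs ▸ ha') ndr nds nrs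
      · exact three_le_card (H.adj_symm (hur ▸ ha)) (H.adj_symm (hqr ▸ ha')) (hrs ▸ ha') nuq nus nqs
      · exact three_le_card (H.adj_symm (hps ▸ ha')) (H.adj_symm (hqs ▸ ha'))
          (H.adj_symm (hrs ▸ ha')) npq npr nqr
    · obtain ⟨hv, hur, hus, h0', -⟩ := hM _ _ hm
      obtain ⟨-, -, hdp⟩ := hN d p (by grind) ho.dp_ne
      obtain ⟨-, -, hdq⟩ := hN d q (by grind) ho.dq_ne
      obtain ⟨-, -, hpr⟩ := hN p r (by grind) ho.pr_ne
      obtain ⟨-, -, hps⟩ := hN p s (by grind) ho.ps_ne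
      obtain ⟨-, -, hqr⟩ := hN q r (by grind) ho.qr_ne
      obtain ⟨-, -, hqs⟩ := hN q s (by grind) ho.qs_ne
      have he : e = -a := by rw [← ho.rs, hv]
      rw [ho.dq] at hdq
      rw [ho.pr, he] at hpr
      rw [ho.ps, he] at hps
      rw [ho.qr, he] at hqr
      rw [ho.qs, he] at hqs
      have hb := ho.dp_ne
      have hb' := sign_neg_ne_zero _ hb
      have ha' := sign_neg_ne_zero _ ha
      obtain ⟨ψ, h1, h2, h3⟩ := recolour_split_rung hφ hH hu ha hb hur hus hdp hdq hpr hps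
        hqr hqs nrs npq ndr nds nud nup nuq f
      refine ⟨ψ, h1, h2, fin ψ h3 ?_⟩
      rintro z (rfl | rfl | rfl | rfl)
      · exact three_le_card (H.adj_symm (hdp ▸ hb)) (hpr ▸ ha') (hps ▸ ha') ndr nds nrs
      · exact three_le_card (H.adj_symm (hdq ▸ hb')) (hqr ▸ ha') (hqs ▸ ha') ndr nds nrs
      · exact three_le_card (H.adj_symm (hur ▸ ha)) (H.adj_symm (hpr ▸ ha'))
          (H.adj_symm (hqr ▸ ha')) nup nuq npq
      · exact three_le_card (H.adj_symm (hus ▸ ha)) (H.adj_symm (hps ▸ ha'))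
          (H.adj_symm (hqs ▸ ha')) nup nuq npq
  by_cases m1 : M d p
  · exact key ho (Or.inl m1)
  by_cases m2 : M d q
  · exact key ho.swap_ends (Or.inl m2)
  by_cases m3 : M p r
  · exact key ho (Or.inr (Or.inl m3))
  by_cases m4 : M p s
  · exact key ho.swap_mids (Or.inr (Or.inl m4))
  by_cases m5 : M q r
  · exact key ho.swap_ends (Or.inr (Or.inl m5))
  by_cases m6 : M q s
  · exact key ho.swap_ends.swap_mids (Or.inr (Or.inl m6))
  by_cases m7 : M r s
  · exact key ho (Or.inr (Or.inr m7))
  exact absurd (ho.transport (hN _ _ m1 ho.dp_ne).2.2 (hN _ _ m2 ho.dq_ne).2.2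
    (hN _ _ m3 ho.pr_ne).2.2 (hN _ _ m4 ho.ps_ne).2.2 (hN _ _ m5 ho.qr_ne).2.2
    (hN _ _ m6 ho.qs_ne).2.2 (hN _ _ m7 ho.rs_ne).2.2) (hU _ _ _ _ _ _)

/-- Colourability of all smaller graphs in the class considered. -/
def SmallerColourable (H : Signing V) : Prop :=
  ∀ G : Signing V, G.Subcubic → G.Proper → G.Unobstructed →
    (∀ z t, G z t ≠ 0 → ∃ t', H z t' ≠ 0) → ∃ φ, G.IsColouring rook φ

theorem separate_of_nonadjacent (hφ : H.IsColouring rook φ) (hH : H.Subcubic) (hP : H.Proper)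
    (hU : H.Unobstructed) (IH : H.SmallerColourable) {w : V} (huw : u ≠ w)
    (hu : (H.nbrs u).card ≤ 2) (hw : (H.nbrs w).card ≤ 2) (hadj : H u w = 0) (ha : a ≠ 0)
    (hxy : x ≠ y) (hux : H u x = a) (huy : H u y = a) (h0 : H x y = 0) :
    ∃ ψ, H.IsColouring rook ψ ∧ ψ u ≠ ψ w := by
  have ha' := sign_neg_ne_zero a ha
  have nux := H.ne_of_adj (hux ▸ ha)
  have nuy := H.ne_of_adj (huy ▸ ha)
  have nwx : w ≠ x := by rintro rfl; exact ha (hux ▸ hadj)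
  have nwy : w ≠ y := by rintro rfl; exact ha (huy ▸ hadj)
  have eu := eq_of_two hu (hux ▸ ha) (huy ▸ ha) hxy
  have hsub := H.delete_sub {u}
  -- In a colouring of the graph with `u` replaced by an edge `xy` of sign `-a`, the ends of that
  -- edge are not in the rigid position, so `u` can be put back with a colour different from that of
  -- `w`.
  by_cases hGU : ((H.delete {u}).setEdge x y (-a) hxy).Unobstructed
  swap
  · simp only [Unobstructed, not_forall, not_not] at hGU
    obtain ⟨e, d, p, q, r, s, ho⟩ := hGU
    obtain ⟨ψ, h1, h2, h3⟩ := recolour_of_obstruction hφ hH hU hu ha hxy hux huy h0 ho (φ w)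
    exact ⟨ψ, h1, by rwa [h3 w huw.symm hw]⟩
  by_cases hGP : ((H.delete {u}).setEdge x y (-a) hxy).Proper
  · obtain ⟨ψ, hψ⟩ := IH _ (by
      intro z
      by_cases hzx : z = x
      · have h1 := card_nbrs_setEdge_le (H.delete {u}) (a := -a) hxy z
        have h2 := H.card_nbrs_delete_lt (R := {u}) (x := z) rfl
          (by rw [hzx, H.symm, hux]; exact ha)
        have := hH z
        omega
      by_cases hzy : z = y
      · have h1 := card_nbrs_setEdge_le (H.delete {u}) (a := -a) hxy z
        have h2 := H.card_nbrs_delete_lt (R := {u}) (x := z) rfl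
          (by rw [hzy, H.symm, huy]; exact ha)
        have := hH z
        omega
      · rw [nbrs_setEdge_of_ne _ _ hzx hzy]
        exact hH.mono hsub z) hGP hGU (by
      intro z t hzt
      by_cases h : (z = x ∧ t = y) ∨ (z = y ∧ t = x)
      · rcases h with ⟨rfl, -⟩ | ⟨rfl, -⟩
        · exact ⟨u, by rw [H.symm, hux]; exact ha⟩
        · exact ⟨u, by rw [H.symm, huy]; exact ha⟩
      · rw [setEdge_of_ne _ _ h] at hzt
        exact ⟨t, hsub.adj hzt⟩)
    have hxy' : rook (ψ x) (ψ y) = -a := by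
      rw [← setEdge_same (H.delete {u}) (a := -a) hxy]
      exact hψ x y (by rw [setEdge_same]; exact ha')
    obtain ⟨χ, h1, h2, h3⟩ := IsColouring.recolour (G := H) (φ := ψ) (u := u)
      (by
        intro z t hz ht hzt
        have h : ¬((z = x ∧ t = y) ∨ (z = y ∧ t = x)) := by
          rintro (⟨rfl, rfl⟩ | ⟨rfl, rfl⟩)
          · exact hzt h0
          · exact hzt (by rw [H.symm]; exact h0)
        have h4 : (H.delete {u}).setEdge x y (-a) hxy z t = H z t := by
          rw [setEdge_of_ne _ _ h, delete_apply H (R := {u}) hz ht]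
        rw [← h4] at hzt ⊢
        exact hψ z t hzt) hu
      (by
        intro z t hz ht _
        rcases eu z hz with rfl | rfl <;> rcases eu t ht with rfl | rfl <;> simp [hux, huy])
      (by
        intro z t hz ht hzt _
        have hna : -a ≠ a := (sign_ne_neg a ha).symm
        rcases eu z hz with rfl | rfl <;> rcases eu t ht with rfl | rfl
        · exact absurd rfl hzt
        · rw [hxy', hux]; exact hna
        · rw [rook_symm, hxy', huy]; exact hna
        · exact absurd rfl hzt) (ψ w)
    exact ⟨χ, h1, by rwa [h3 w huw.symm]⟩
  · set G := (H.delete {u}).setEdge x y (-a) hxy with hG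
    -- Properness can fail only if the new edge makes the component of `x` cubic. Together with `u`
    -- this component is closed in `H`, and it misses `w`, whose degree is at most two.
    have hno : ¬ ∃ z, G.Reach x z ∧ (G.nbrs z).card ≤ 2 := fun h =>
      hGP (proper_setEdge hxy ha' (hP.mono hH hsub) h)
    have hGy : G x y ≠ 0 := by rw [hG, setEdge_same]; exact ha'
    have hru : ∀ z, G.Reach x z → z ≠ u := by
      rintro z hz rfl
      refine hno ⟨z, hz, ?_⟩
      rw [hG, nbrs_setEdge_of_ne _ _ nux nuy, card_nbrs_delete_of_mem _ (by simp)]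
      omega
    refine hφ.separate (K := fun z => z = u ∨ G.Reach x z) ?_ (Or.inl rfl) ?_
    · rintro z t (rfl | hz) hzt
      · rcases eu t hzt with rfl | rfl
        · exact Or.inr Relation.ReflTransGen.refl
        · exact Or.inr (Relation.ReflTransGen.single hGy)
      · by_cases htu : t = u
        · exact Or.inl htu
        · refine Or.inr (Relation.ReflTransGen.tail hz (setEdge_adj _ hxy ha' ?_))
          rwa [delete_apply H (R := {u}) (hru z hz) htu]
    · rintro (h | h)
      · exact huw h.symm
      · refine hno ⟨w, h, ?_⟩
        rw [hG, nbrs_setEdge_of_ne _ _ nwx nwy]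
        exact (Finset.card_le_card (nbrs_mono (fun _ _ => hsub.adj) w)).trans hw

end Nonadjacent


variable {V : Type*} [Fintype V]

/-! ### Separating `u` from `w` when `u` lies in a monochromatic triangle. -/

section Triangle

variable {H : Signing V} {φ : V → Fin 9} {u x y : V} {a : SignType}

theorem recolour_triangle_leaf (hφ : H.IsColouring rook φ)
    (hu : (H.nbrs u).card ≤ 2) (ha : a ≠ 0) (hux : H u x = a) (huy : H u y = a) (hxy : H x y = a)
    (hx : ∀ z, H x z ≠ 0 → z = u ∨ z = y) (f : Fin 9) :
    ∃ ψ, H.IsColouring rook ψ ∧ ψ u ≠ f ∧ ∀ z, z ≠ u → z ≠ x → ψ z = φ z := by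
  have nux := H.ne_of_adj (hux ▸ ha)
  have nuy := H.ne_of_adj (huy ▸ ha)
  have nxy := H.ne_of_adj (hxy ▸ ha)
  have eu := eq_of_two hu (hux ▸ ha) (huy ▸ ha) nxy
  have hxu := H.symm u x ▸ hux
  obtain ⟨c, hcf, hcy⟩ := rook_extend_one (φ y) f a ha
  obtain ⟨k, hkc, hky⟩ := rook_third c (φ y) a hcy ha
  obtain ⟨ψ, h1, h2, h3⟩ := IsColouring.patch (G := H) rook_symm (φ := φ)
    [(u, c), (x, k)] (fun x y _ _ h => hφ x y h) (by simp [nux]) (by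
      intro ψ h2 h3
      simp only [List.mem_cons, List.not_mem_nil, or_false, forall_eq_or_imp, forall_eq,
        List.map_cons, List.map_nil, not_or, and_imp] at h2 h3 ⊢
      obtain ⟨vu, vx⟩ := h2
      have vy := h3 y nuy.symm nxy.symm
      refine ⟨?_, ?_⟩
      · intro z hz
        rcases eu z hz with rfl | rfl
        · rw [vx, rook_symm, hkc, hux]
        · rw [vy, hcy, huy]
      · intro z hz
        rcases hx z hz with rfl | rfl
        · rw [vu, hkc, hxu]
        · rw [vy, hky, hxy])
  simp only [List.mem_cons, List.not_mem_nil, or_false, forall_eq_or_imp, forall_eq,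
    List.map_cons, List.map_nil, not_or, and_imp] at h2 h3
  exact ⟨ψ, h1, h2.1 ▸ hcf, h3⟩

/-- The colouring need only be valid off the triangle, because it may come from an auxiliary graph
in which the triangle has been dismantled. -/
theorem recolour_triangle (hH : H.Subcubic)
    (hφ : ∀ z t, z ≠ u → z ≠ x → z ≠ y → t ≠ u → t ≠ x → t ≠ y → H z t ≠ 0 →
      rook (φ z) (φ t) = H z t)
    (hu : (H.nbrs u).card ≤ 2) (ha : a ≠ 0) (hux : H u x = a) (huy : H u y = a) (hxy : H x y = a)
    {p q : V} (hp : H x p ≠ 0) (hpu : p ≠ u) (hpy : p ≠ y) (hq : H y q ≠ 0) (hqu : q ≠ u)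
    (hqx : q ≠ x) (hpq : φ p = φ q → H x p = a → H y q ≠ a) (f : Fin 9) :
    ∃ ψ, H.IsColouring rook ψ ∧ ψ u ≠ f ∧ ∀ z, z ≠ u → z ≠ x → z ≠ y → ψ z = φ z := by
  have nux := H.ne_of_adj (hux ▸ ha)
  have nuy := H.ne_of_adj (huy ▸ ha)
  have nxy := H.ne_of_adj (hxy ▸ ha)
  have nxp := H.ne_of_adj hp
  have nyq := H.ne_of_adj hq
  have hxu := H.symm u x ▸ hux
  have hyu := H.symm u y ▸ huy
  have hyx := H.symm x y ▸ hxy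
  have eu := eq_of_two hu (hux ▸ ha) (huy ▸ ha) nxy
  have ex := eq_of_three (hH x) (hxu ▸ ha) (hxy ▸ ha) hp nuy hpu.symm hpy.symm
  have ey := eq_of_three (hH y) (hyu ▸ ha) (hyx ▸ ha) hq nux hqu.symm hqx.symm
  obtain ⟨k, hk, l, hl, hkl, c, hcf, hck, hcl⟩ := rook_triangle _ _ _ _ a f hp hq ha hpq
  obtain ⟨ψ, h1, h2, h3⟩ := IsColouring.patch (G := H) rook_symm (φ := φ)
    [(u, c), (x, k), (y, l)] (by
      intro z t hz ht
      simp only [List.mem_cons, List.not_mem_nil, or_false,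
        List.map_cons, List.map_nil, not_or] at hz ht
      exact hφ z t hz.1 hz.2.1 hz.2.2 ht.1 ht.2.1 ht.2.2) (by simp [nux, nuy, nxy]) (by
      intro ψ h2 h3
      simp only [List.mem_cons, List.not_mem_nil, or_false, forall_eq_or_imp, forall_eq,
        List.map_cons, List.map_nil, not_or, and_imp] at h2 h3 ⊢
      obtain ⟨vu, vx, vy⟩ := h2
      have vp := h3 p hpu nxp.symm hpy
      have vq := h3 q hqu hqx nyq.symm
      refine ⟨?_, ?_, ?_⟩
      · intro z hz
        rcases eu z hz with rfl | rfl
        · rw [vx, hck, hux]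
        · rw [vy, hcl, huy]
      · intro z hz
        rcases ex z hz with rfl | rfl | rfl
        · rw [vu, rook_symm, hck, hxu]
        · rw [vy, hkl, hxy]
        · rw [vp, hk]
      · intro z hz
        rcases ey z hz with rfl | rfl | rfl
        · rw [vu, rook_symm, hcl, hyu]
        · rw [vx, rook_symm, hkl, hyx]
        · rw [vq, hl])
  simp only [List.mem_cons, List.not_mem_nil, or_false, forall_eq_or_imp, forall_eq,
    List.map_cons, List.map_nil, not_or, and_imp] at h2 h3
  exact ⟨ψ, h1, h2.1 ▸ hcf, h3⟩

/-- Both `u` and `q` see `x` and `y` in sign `a`, so they can share a colour `c`. At most one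
further edge at `q` constrains `c`, which leaves room to avoid `f`; then `x` and `y` complete a
triangle with `c`. -/
theorem recolour_diamond (hφ : H.IsColouring rook φ) (hH : H.Subcubic)
    (hu : (H.nbrs u).card ≤ 2) (ha : a ≠ 0) (hux : H u x = a) (huy : H u y = a) (hxy : H x y = a)
    {q : V} (hxq : H x q = a) (hyq : H y q = a) (hqu : q ≠ u) (f : Fin 9) :
    ∃ ψ, H.IsColouring rook ψ ∧ ψ u ≠ f ∧ ∀ z, z ≠ u → z ≠ x → z ≠ y → z ≠ q → ψ z = φ z := by
  have nux := H.ne_of_adj (hux ▸ ha)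
  have nuy := H.ne_of_adj (huy ▸ ha)
  have nxy := H.ne_of_adj (hxy ▸ ha)
  have nxq := H.ne_of_adj (hxq ▸ ha)
  have nyq := H.ne_of_adj (hyq ▸ ha)
  have hxu := H.symm u x ▸ hux
  have hyu := H.symm u y ▸ huy
  have hyx := H.symm x y ▸ hxy
  have hqx := H.symm x q ▸ hxq
  have hqy := H.symm y q ▸ hyq
  have eu := eq_of_two hu (hux ▸ ha) (huy ▸ ha) nxy
  have ex := eq_of_three (hH x) (hxu ▸ ha) (hxy ▸ ha) (hxq ▸ ha) nuy hqu.symm nyq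
  have ey := eq_of_three (hH y) (hyu ▸ ha) (hyx ▸ ha) (hyq ▸ ha) nux hqu.symm nxq
  obtain ⟨c, hcf, hc⟩ : ∃ c, c ≠ f ∧ ∀ z, H q z ≠ 0 → z ≠ x → z ≠ y → rook c (φ z) = H q z := by
    by_cases h : ∃ t, H q t ≠ 0 ∧ t ≠ x ∧ t ≠ y
    · obtain ⟨t, ht, htx, hty⟩ := h
      obtain ⟨c, hcf, hc⟩ := rook_extend_one (φ t) f _ ht
      refine ⟨c, hcf, fun z hz hzx hzy => ?_⟩
      rcases eq_of_three (hH q) (hqx ▸ ha) (hqy ▸ ha) ht nxy htx.symm hty.symm z hz with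
        rfl | rfl | rfl
      · exact absurd rfl hzx
      · exact absurd rfl hzy
      · exact hc
    · exact ⟨rookShift f, rookShift_ne f, fun z hz hzx hzy => absurd ⟨z, hz, hzx, hzy⟩ h⟩
  obtain ⟨k, hk, l, hl, hkl⟩ := rook_triangle_one c a ha
  obtain ⟨ψ, h1, h2, h3⟩ := IsColouring.patch (G := H) rook_symm (φ := φ)
    [(u, c), (x, k), (y, l), (q, c)] (fun x y _ _ h => hφ x y h)
    (by simp [nux, nuy, nxy, nxq, nyq, hqu.symm]) (by
      intro ψ h2 h3
      simp only [List.mem_cons, List.not_mem_nil, or_false, forall_eq_or_imp, forall_eq,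
        List.map_cons, List.map_nil, not_or, and_imp] at h2 h3 ⊢
      obtain ⟨vu, vx, vy, vq⟩ := h2
      refine ⟨?_, ?_, ?_, ?_⟩
      · intro z hz
        rcases eu z hz with rfl | rfl
        · rw [vx, hk, hux]
        · rw [vy, hl, huy]
      · intro z hz
        rcases ex z hz with rfl | rfl | rfl
        · rw [vu, rook_symm, hk, hxu]
        · rw [vy, hkl, hxy]
        · rw [vq, rook_symm, hk, hxq]
      · intro z hz
        rcases ey z hz with rfl | rfl | rfl
        · rw [vu, rook_symm, hl, hyu]
        · rw [vx, rook_symm, hkl, hyx]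
        · rw [vq, rook_symm, hl, hyq]
      · intro z hz
        by_cases hzx : z = x
        · rw [hzx, vx, hk, hqx]
        by_cases hzy : z = y
        · rw [hzy, vy, hl, hqy]
        have hzu : z ≠ u := by
          rintro rfl
          rcases eu q (H.adj_symm hz) with rfl | rfl
          · exact nxq rfl
          · exact nyq rfl
        rw [h3 z hzu hzx hzy (H.ne_of_adj hz).symm]
        exact hc z hz hzx hzy)
  simp only [List.mem_cons, List.not_mem_nil, or_false, forall_eq_or_imp, forall_eq,
    List.map_cons, List.map_nil, not_or, and_imp] at h2 h3
  exact ⟨ψ, h1, h2.1 ▸ hcf, h3⟩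

/-- The case where `u` lies in a monochromatic triangle `u, x, y` whose other two edges have the
same sign and lead to distinct vertices `p` and `q`. -/
theorem separate_of_prism (hφ : H.IsColouring rook φ) (hH : H.Subcubic) (hP : H.Proper)
    (hU : H.Unobstructed) (IH : H.SmallerColourable) {w : V} (huw : u ≠ w)
    (hu : (H.nbrs u).card ≤ 2) (hw : (H.nbrs w).card ≤ 2) (hadj : H u w = 0) (ha : a ≠ 0)
    (hux : H u x = a) (huy : H u y = a) (hxy : H x y = a) {p q : V} (hxp : H x p = a)
    (hyq : H y q = a) (hpu : p ≠ u) (hpy : p ≠ y) (hqu : q ≠ u) (hqx : q ≠ x) (hpq : p ≠ q) :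
    ∃ ψ, H.IsColouring rook ψ ∧ ψ u ≠ ψ w := by
  have ha' := sign_neg_ne_zero a ha
  have nux := H.ne_of_adj (hux ▸ ha)
  have nuy := H.ne_of_adj (huy ▸ ha)
  have nxy := H.ne_of_adj (hxy ▸ ha)
  have nxp := H.ne_of_adj (hxp ▸ ha)
  have nyq := H.ne_of_adj (hyq ▸ ha)
  have nwx : w ≠ x := by rintro rfl; exact ha (hux ▸ hadj)
  have nwy : w ≠ y := by rintro rfl; exact ha (huy ▸ hadj)
  have hxu := H.symm u x ▸ hux
  have hyu := H.symm u y ▸ huy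
  have hyx := H.symm x y ▸ hxy
  have hpx := H.symm x p ▸ hxp
  have hqy := H.symm y q ▸ hyq
  have eu := eq_of_two hu (hux ▸ ha) (huy ▸ ha) nxy
  have ex := eq_of_three (hH x) (hxu ▸ ha) (hxy ▸ ha) (hxp ▸ ha) nuy hpu.symm hpy.symm
  have ey := eq_of_three (hH y) (hyu ▸ ha) (hyx ▸ ha) (hyq ▸ ha) nux hqu.symm hqx.symm
  have hsub := H.delete_sub {u, y}
  set G := (H.delete {u, y}).setEdge x q (-a) hqx.symm with hG
  have hxq : G x q = -a := setEdge_same _ _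
  have hGH : ∀ z t, G z t ≠ 0 → (z = x ∧ t = q) ∨ (z = q ∧ t = x) ∨
      (z ≠ u ∧ z ≠ y ∧ t ≠ u ∧ t ≠ y ∧ H z t = G z t) := by
    intro z t hzt
    by_cases h : (z = x ∧ t = q) ∨ (z = q ∧ t = x)
    · tauto
    · have h1 : G z t = H.delete {u, y} z t := setEdge_of_ne _ _ h
      rw [h1] at hzt ⊢
      obtain ⟨h2, h3, h4⟩ := H.delete_adj hzt
      simp only [Set.mem_insert_iff, Set.mem_singleton_iff, not_or] at h2 h3
      exact Or.inr (Or.inr ⟨h2.1, h2.2, h3.1, h3.2, h4.symm⟩)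
  have hHG : ∀ z t, z ≠ u → z ≠ y → z ≠ x → t ≠ u → t ≠ y → t ≠ x → G z t = H z t := by
    intro z t h1 h2 h3 h4 h5 h6
    rw [hG, setEdge_of_ne _ _ (by tauto), delete_apply _ (by simp [h1, h2]) (by simp [h4, h5])]
  have eGx : ∀ z, G x z ≠ 0 → z = p ∨ z = q := by
    intro z hz
    rcases hGH x z hz with ⟨-, h⟩ | ⟨h, -⟩ | ⟨-, -, h1, h2, h3⟩
    · exact Or.inr h
    · exact absurd h.symm hqx
    · rcases ex z (h3 ▸ hz) with h | h | h
      · exact absurd h h1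
      · exact absurd h h2
      · exact Or.inl h
  -- The vertex `x` loses `u` and `y` and gains `q`. Its low degree keeps `G` proper and bars `x`
  -- from every role in an obstruction except that of `d`.
  have hdx : (G.nbrs x).card ≤ 2 := by
    classical
    refine (Finset.card_le_card (t := {p, q}) fun z hz => ?_).trans Finset.card_le_two
    rw [Finset.mem_insert, Finset.mem_singleton]
    exact eGx z (mem_nbrs.1 hz)
  by_cases hGU : G.Unobstructed
  · obtain ⟨ψ, hψ⟩ := IH G (by
      intro z
      by_cases hzx : z = x
      · rw [hzx]; omega
      by_cases hzq : z = q
      · have h1 := card_nbrs_setEdge_le (H.delete {u, y}) (a := -a) hqx.symm z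
        have h2 := H.card_nbrs_delete_lt (R := {u, y}) (x := z) (r := y) (by simp)
          (by rw [hzq, hqy]; exact ha)
        have := hH z
        rw [hG]
        omega
      · rw [hG, nbrs_setEdge_of_ne _ _ hzx hzq]
        exact hH.mono hsub z)
      (proper_setEdge _ ha' (hP.mono hH hsub) ⟨x, Relation.ReflTransGen.refl, hdx⟩) hGU (by
      intro z t hzt
      rcases hGH z t hzt with ⟨rfl, -⟩ | ⟨rfl, -⟩ | ⟨-, -, -, -, h⟩
      · exact ⟨u, hxu ▸ ha⟩
      · exact ⟨y, hqy ▸ ha⟩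
      · exact ⟨t, h ▸ hzt⟩)
    have hxp' : G x p = a := by
      rw [hG, setEdge_of_ne _ _ (by rintro (⟨-, h⟩ | ⟨h, -⟩); exacts [hpq h, hqx h.symm]),
        delete_apply _ (by simp [nux.symm, nxy]) (by simp [hpu, hpy]), hxp]
    -- The auxiliary edge makes `x` see `p` and `q` with different signs.
    have hne : ψ p ≠ ψ q := by
      intro h
      have := hψ.sign_eq (hxp' ▸ ha) (hxq ▸ ha') h
      rw [hxp', hxq] at this
      exact sign_ne_neg a ha this
    obtain ⟨χ, h1, h2, h3⟩ := recolour_triangle (φ := ψ) hH (by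
        intro z t h1 h2 h3 h4 h5 h6 h7
        rw [← hHG z t h1 h3 h2 h4 h6 h5] at h7 ⊢
        exact hψ z t h7) hu ha hux huy hxy (hxp ▸ ha) hpu hpy (hyq ▸ ha) hqu hqx
        (fun h => absurd h hne) (ψ w)
    exact ⟨χ, h1, by rwa [h3 w huw.symm nwx nwy]⟩
  · simp only [Unobstructed, not_forall, not_not] at hGU
    obtain ⟨e, d, i, j, r, s, ho⟩ := hGU
    have npq := ho.pq_ne
    have ndr := ho.dr_ne
    have nds := ho.ds_ne
    have npr := G.ne_of_adj ho.pr_ne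
    have nps := G.ne_of_adj ho.ps_ne
    have nqr := G.ne_of_adj ho.qr_ne
    have nqs := G.ne_of_adj ho.qs_ne
    have nrs := G.ne_of_adj ho.rs_ne
    have nix : i ≠ x := by
      rintro rfl
      exact three_le_card (G.adj_symm ho.dp_ne) ho.pr_ne ho.ps_ne ndr nds nrs hdx
    have njx : j ≠ x := by
      rintro rfl
      exact three_le_card (G.adj_symm ho.dq_ne) ho.qr_ne ho.qs_ne ndr nds nrs hdx
    have nrx : r ≠ x := by
      rintro rfl
      exact three_le_card (G.adj_symm ho.pr_ne) (G.adj_symm ho.qr_ne) ho.rs_ne npq nps nqs hdx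
    have nsx : s ≠ x := by
      rintro rfl
      exact three_le_card (G.adj_symm ho.ps_ne) (G.adj_symm ho.qs_ne) (G.adj_symm ho.rs_ne)
        npq npr nqr hdx
    have hold : ∀ z t, z ≠ x → t ≠ x → G z t ≠ 0 →
        z ≠ u ∧ z ≠ y ∧ t ≠ u ∧ t ≠ y ∧ H z t = G z t := by
      intro z t hz ht hzt
      rcases hGH z t hzt with ⟨h, -⟩ | ⟨-, h⟩ | h
      · exact absurd h hz
      · exact absurd h ht
      · exact h
    have hir := hold i r nix nrx ho.pr_ne
    have his := hold i s nix nsx ho.ps_ne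
    have hjr := hold j r njx nrx ho.qr_ne
    have hjs := hold j s njx nsx ho.qs_ne
    have hrs := hold r s nrx nsx ho.rs_ne
    -- Otherwise the obstruction avoids the new edge and already lies in `H`.
    have hdx' : d = x := by
      by_contra hd
      exact hU _ _ _ _ _ _ (ho.transport (hold d i hd nix ho.dp_ne).2.2.2.2
        (hold d j hd njx ho.dq_ne).2.2.2.2 hir.2.2.2.2 his.2.2.2.2 hjr.2.2.2.2 hjs.2.2.2.2
        hrs.2.2.2.2)
    have hiH : H i r ≠ 0 := hir.2.2.2.2 ▸ ho.pr_ne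
    have hiH' : H i s ≠ 0 := his.2.2.2.2 ▸ ho.ps_ne
    have hjH : H j r ≠ 0 := hjr.2.2.2.2 ▸ ho.qr_ne
    have hjH' : H j s ≠ 0 := hjs.2.2.2.2 ▸ ho.qs_ne
    have hrH : H r s ≠ 0 := hrs.2.2.2.2 ▸ ho.rs_ne
    have hij : ∀ z, z = i ∨ z = j → z = p ∨ z = q := by
      rintro z (rfl | rfl)
      · exact eGx _ (hdx' ▸ ho.dp_ne)
      · exact eGx _ (hdx' ▸ ho.dq_ne)
    have hpx' : ∃ t, H p t ≠ 0 ∧ t ≠ r ∧ t ≠ s ∧ (t = u ∨ t = x ∨ t = y) :=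
      ⟨x, hpx ▸ ha, nrx.symm, nsx.symm, Or.inr (Or.inl rfl)⟩
    have hqy' : ∃ t, H q t ≠ 0 ∧ t ≠ r ∧ t ≠ s ∧ (t = u ∨ t = x ∨ t = y) :=
      ⟨y, hqy ▸ ha, hrs.2.1.symm, hrs.2.2.2.1.symm, Or.inr (Or.inr rfl)⟩
    have hends : ∀ z, z = i ∨ z = j → ∃ t, H z t ≠ 0 ∧ t ≠ r ∧ t ≠ s ∧ (t = u ∨ t = x ∨ t = y) := by
      intro z hz
      rcases hij z hz with rfl | rfl
      · exact hpx'
      · exact hqy'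
    obtain ⟨ti, hti, htir, htis, htiu⟩ := hends i (Or.inl rfl)
    obtain ⟨tj, htj, htjr, htjs, htju⟩ := hends j (Or.inr rfl)
    have ei := eq_of_three (hH i) hti hiH hiH' htir htis nrs
    have ej := eq_of_three (hH j) htj hjH hjH' htjr htjs nrs
    have er := eq_of_three (hH r) (H.adj_symm hiH) (H.adj_symm hjH) hrH npq nps nqs
    have es := eq_of_three (hH s) (H.adj_symm hiH') (H.adj_symm hjH') (H.adj_symm hrH) npq npr nqr
    have hpij : p = i ∨ p = j := by
      rcases hij i (Or.inl rfl) with h | h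
      · exact Or.inl h.symm
      · rcases hij j (Or.inr rfl) with h' | h'
        · exact Or.inr h'.symm
        · exact absurd (h.trans h'.symm) npq
    have hqij : q = i ∨ q = j := by
      rcases hij i (Or.inl rfl) with h | h
      · rcases hij j (Or.inr rfl) with h' | h'
        · exact absurd (h.trans h'.symm) npq
        · exact Or.inr h'.symm
      · exact Or.inl h.symm
    -- Now `p` and `q` are the ends `i`, `j` of the obstruction, and their third edges lead back to
    -- the triangle. These vertices are closed under adjacency in `H`, and none of them is `w`.
    refine hφ.separate (K := fun z => z = u ∨ z = x ∨ z = y ∨ z = i ∨ z = j ∨ z = r ∨ z = s) ?_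
      (Or.inl rfl) ?_
    · rintro z t (rfl | rfl | rfl | rfl | rfl | rfl | rfl) hzt
      · rcases eu t hzt with h | h <;> simp only [h, true_or, or_true]
      · rcases ex t hzt with h | h | h
        · simp only [h, true_or]
        · simp only [h, true_or, or_true]
        · rcases hpij with h' | h' <;> simp only [h, h', true_or, or_true]
      · rcases ey t hzt with h | h | h
        · simp only [h, true_or]
        · simp only [h, true_or, or_true]
        · rcases hqij with h' | h' <;> simp only [h, h', true_or, or_true]
      · rcases ei t hzt with h | h | h
        · rcases htiu with h' | h' | h' <;> simp only [h, h', true_or, or_true]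
        · simp only [h, true_or, or_true]
        · simp only [h, or_true]
      · rcases ej t hzt with h | h | h
        · rcases htju with h' | h' | h' <;> simp only [h, h', true_or, or_true]
        · simp only [h, true_or, or_true]
        · simp only [h, or_true]
      · rcases er t hzt with h | h | h <;> simp only [h, true_or, or_true]
      · rcases es t hzt with h | h | h <;> simp only [h, true_or, or_true]
    · rintro (h | h | h | rfl | rfl | rfl | rfl)
      · exact huw h.symm
      · exact nwx h
      · exact nwy h
      · exact three_le_card hti hiH hiH' htir htis nrs hw
      · exact three_le_card htj hjH hjH' htjr htjs nrs hw
      · exact three_le_card (H.adj_symm hiH) (H.adj_symm hjH) hrH npq nps nqs hw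
      · exact three_le_card (H.adj_symm hiH') (H.adj_symm hjH') (H.adj_symm hrH) npq npr nqr hw

/-- Recolouring the triangle fails only when its outer edges both have sign `a` and lead to equal
colours: their ends coincide (a diamond) or are distinct (a prism). `hex` ensures that `w` is not
the far vertex of the diamond. -/
theorem separate_of_triangle (hφ : H.IsColouring rook φ) (hH : H.Subcubic) (hP : H.Proper)
    (hU : H.Unobstructed) (IH : H.SmallerColourable) {w : V} (huw : u ≠ w)
    (hu : (H.nbrs u).card ≤ 2) (hw : (H.nbrs w).card ≤ 2) (hadj : H u w = 0) (ha : a ≠ 0)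
    (hux : H u x = a) (huy : H u y = a) (hxy : H x y = a) (hex : H w x = a → H w y ≠ a) :
    ∃ ψ, H.IsColouring rook ψ ∧ ψ u ≠ ψ w := by
  have nwx : w ≠ x := by rintro rfl; exact ha (hux ▸ hadj)
  have nwy : w ≠ y := by rintro rfl; exact ha (huy ▸ hadj)
  have nxy := H.ne_of_adj (hxy ▸ ha)
  have hyx : H y x = a := H.symm x y ▸ hxy
  by_cases hx : ∃ p, H x p ≠ 0 ∧ p ≠ u ∧ p ≠ y
  swap
  · obtain ⟨ψ, h1, h2, h3⟩ := recolour_triangle_leaf hφ hu ha hux huy hxy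
      (fun z hz => by by_contra h; exact hx ⟨z, hz, by tauto⟩) (φ w)
    exact ⟨ψ, h1, by rwa [h3 w huw.symm nwx]⟩
  by_cases hy : ∃ q, H y q ≠ 0 ∧ q ≠ u ∧ q ≠ x
  swap
  · obtain ⟨ψ, h1, h2, h3⟩ := recolour_triangle_leaf hφ hu ha huy hux hyx
      (fun z hz => by by_contra h; exact hy ⟨z, hz, by tauto⟩) (φ w)
    exact ⟨ψ, h1, by rwa [h3 w huw.symm nwy]⟩
  obtain ⟨p, hp, hpu, hpy⟩ := hx
  obtain ⟨q, hq, hqu, hqx⟩ := hy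
  by_cases hc : φ p = φ q → H x p = a → H y q ≠ a
  · obtain ⟨ψ, h1, h2, h3⟩ := recolour_triangle hH (fun z t _ _ _ _ _ _ h => hφ z t h) hu ha hux
      huy hxy hp hpu hpy hq hqu hqx hc (φ w)
    exact ⟨ψ, h1, by rwa [h3 w huw.symm nwx nwy]⟩
  · simp only [not_forall, not_not, ne_eq] at hc
    obtain ⟨-, hxp, hyq⟩ := hc
    by_cases hpq : p = q
    · subst hpq
      obtain ⟨ψ, h1, h2, h3⟩ := recolour_diamond hφ hH hu ha hux huy hxy hxp hyq hpu (φ w)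
      have hwp : w ≠ p := by
        rintro rfl
        exact hex (by rw [H.symm, hxp]) (by rw [H.symm, hyq])
      exact ⟨ψ, h1, by rwa [h3 w huw.symm nwx nwy hwp]⟩
    · exact separate_of_prism hφ hH hP hU IH huw hu hw hadj ha hux huy hxy hxp hyq hpu hpy hqu
        hqx hpq

end Triangle

/-! ### The induction for `rook`. -/

/-- Two vertices of degree at most two can be given different colours. -/
theorem exists_separating_colouring {H : Signing V} (hH : H.Subcubic) (hP : H.Proper)
    (hU : H.Unobstructed) (IH : H.SmallerColourable) {u w : V} (huw : u ≠ w)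
    (hu : (H.nbrs u).card ≤ 2) (hw : (H.nbrs w).card ≤ 2)
    (hex : ∀ x y a, a ≠ 0 → H u x = a → H u y = a → H x y = a → H w x = a → H w y ≠ a) :
    ∃ ψ, H.IsColouring rook ψ ∧ ψ u ≠ ψ w := by
  obtain ⟨φ, hφ⟩ := IH H hH hP hU fun _ t h => ⟨t, h⟩
  by_cases hadj : H u w = 0
  swap
  · refine ⟨φ, hφ, fun h => hadj ?_⟩
    rw [← hφ u w hadj, h, rook_self]
  by_cases hc : ∀ x y, H u x ≠ 0 → H u y ≠ 0 → x ≠ y → H u x = H u y →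
      rook (φ x) (φ y) ≠ H u x
  · obtain ⟨ψ, h1, h2, h3⟩ := IsColouring.recolour (fun x y _ _ h => hφ x y h) hu
      (fun x y hx hy h => hφ.sign_eq hx hy h) hc (φ w)
    exact ⟨ψ, h1, by rwa [h3 w huw.symm]⟩
  · simp only [not_forall, not_not, ne_eq] at hc
    obtain ⟨x, y, hx, -, hxy, hs, hr⟩ := hc
    by_cases h0 : H x y = 0
    · exact separate_of_nonadjacent hφ hH hP hU IH huw hu hw hadj hx hxy rfl hs.symm h0
    · have ht : H x y = H u x := by rw [← hφ x y h0, hr]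
      exact separate_of_triangle hφ hH hP hU IH huw hu hw hadj hx rfl hs.symm ht
        (hex x y _ hx rfl hs.symm ht)

/-- Unobstructed subcubic graphs without cubic components map to the rook's graph. -/
theorem exists_rook_colouring (G : Signing V) (hG : G.Subcubic) (hP : G.Proper)
    (hU : G.Unobstructed) : ∃ φ, G.IsColouring rook φ := by
  classical
  induction hn : (Finset.univ.filter fun z => ∃ t, G z t ≠ 0).card using
    Nat.strong_induction_on generalizing G with
  | _ n ih =>
  by_cases hne : ∃ z t, G z t ≠ 0
  swap
  · exact ⟨fun _ => 0, fun x y h => absurd ⟨x, y, h⟩ hne⟩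
  obtain ⟨v, hv, u, hvu⟩ : ∃ v, (G.nbrs v).card ≤ 2 ∧ ∃ u, G v u ≠ 0 := by
    obtain ⟨z, t, hzt⟩ := hne
    obtain ⟨y, hzy, hy⟩ := hP z
    refine ⟨y, hy, ?_⟩
    rcases Relation.ReflTransGen.cases_tail hzy with rfl | ⟨b, -, hb⟩
    · exact ⟨t, hzt⟩
    · exact ⟨b, G.adj_symm hb⟩
  have hsub := G.delete_sub {v}
  have IH : (G.delete {v}).SmallerColourable := by
    intro G' h1 h2 h3 h4
    -- Deleting `v` isolates it, so any graph supported on the remaining nonisolated vertices has a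
    -- smaller measure, even after new edges are added.
    refine ih _ ?_ G' h1 h2 h3 rfl
    rw [← hn]
    refine Finset.card_lt_card ⟨fun z hz => ?_, fun hs => ?_⟩
    · simp only [Finset.mem_filter, Finset.mem_univ, true_and] at hz ⊢
      obtain ⟨t, ht⟩ := hz
      obtain ⟨t', ht'⟩ := h4 z t ht
      exact ⟨t', hsub.adj ht'⟩
    · have := @hs v (by simp only [Finset.mem_filter, Finset.mem_univ, true_and]; exact ⟨u, hvu⟩)
      simp only [Finset.mem_filter, Finset.mem_univ, true_and] at this
      obtain ⟨t, ht⟩ := this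
      obtain ⟨t', ht'⟩ := h4 v t ht
      exact (G.delete_adj ht').1 rfl
  have hext : ∀ φ, (G.delete {v}).IsColouring rook φ →
      (∃ c, ∀ z, G v z ≠ 0 → rook c (φ z) = G v z) → ∃ φ, G.IsColouring rook φ := by
    rintro φ hφ ⟨c, hc⟩
    obtain ⟨ψ, h1, -⟩ := IsColouring.patch (G := G) rook_symm (φ := φ) [(v, c)]
      (by
        intro x y hx hy
        simp only [List.map_cons, List.map_nil, List.mem_singleton] at hx hy
        exact hφ.of_delete x y hx hy) (by simp) (by
        intro ψ h2 h3
        simp only [List.mem_singleton, forall_eq, List.map_cons, List.map_nil] at h2 h3 ⊢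
        intro y hy
        rw [h3 y (G.ne_of_adj hy).symm]
        exact hc y hy)
    exact ⟨ψ, h1⟩
  have hG' := hG.mono hsub
  have hP' := hP.mono hG hsub
  have hU' := hU.mono hsub
  obtain ⟨φ, hφ⟩ := IH _ hG' hP' hU' fun _ t h => ⟨t, h⟩
  by_cases hw : ∃ w, G v w ≠ 0 ∧ u ≠ w
  swap
  · obtain ⟨c, -, hc⟩ := rook_extend_one (φ u) 0 _ hvu
    refine hext φ hφ ⟨c, fun z hz => ?_⟩
    have : u = z := by by_contra h; exact hw ⟨z, hz, h⟩
    rw [← this, hc]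
  obtain ⟨w, hvw, huw⟩ := hw
  have ev := eq_of_two hv hvu hvw huw
  by_cases hs : G v u = G v w
  · obtain ⟨c, hc1, hc2⟩ := rook_extend_same (φ u) (φ w) _ hvu
    refine hext φ hφ ⟨c, fun z hz => ?_⟩
    rcases ev z hz with rfl | rfl
    · exact hc1
    · rw [hc2, hs]
  obtain ⟨ψ, hψ, hne⟩ := exists_separating_colouring hG' hP' hU' IH huw
    (by
      have := G.card_nbrs_delete_lt (R := {v}) rfl (G.adj_symm hvu)
      have := hG u
      omega)
    (by
      have := G.card_nbrs_delete_lt (R := {v}) rfl (G.adj_symm hvw)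
      have := hG w
      omega)
    (by
      intro x y a ha h1 h2 h3 h4 h5
      rw [← hsub _ _ (h1 ▸ ha)] at h1
      rw [← hsub _ _ (h2 ▸ ha)] at h2
      rw [← hsub _ _ (h3 ▸ ha)] at h3
      rw [← hsub _ _ (h4 ▸ ha)] at h4
      rw [← hsub _ _ (h5 ▸ ha)] at h5
      -- A triangle `u`, `x`, `y` with `w` joined to `x` and `y`, all in sign `a`, is an obstruction
      -- in `G` with `v` subdividing `uw`.
      refine hU a v u w x y ⟨ha, hvu, ?_, h1, h2, h4, h5, h3⟩
      rw [sign_eq_neg_of_ne _ _ hvu hvw hs, sign_neg_neg])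
  obtain ⟨c, hc1, hc2⟩ := rook_extend_ne (ψ u) (ψ w) _ _ hvu hvw hne
  refine hext ψ hψ ⟨c, fun z hz => ?_⟩
  rcases ev z hz with rfl | rfl
  · exact hc1
  · exact hc2


variable {V : Type*} [Fintype V]

/-! ### Graphs with obstructions and `rookTop`. -/

/-- A colouring away from an obstruction extends to it in `rookTop`. -/
theorem IsObstruction.exists_rookTop_colouring {G : Signing V} (hG : G.Subcubic) {e : SignType}
    {d p q r s : V} (ho : G.IsObstruction e d p q r s) {φ : V → Option (Fin 9)}
    (hφ : (G.delete {d, p, q, r, s}).IsColouring rookTop φ) :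
    ∃ ψ, G.IsColouring rookTop ψ := by
  have npq := ho.pq_ne
  have ndr := ho.dr_ne
  have nds := ho.ds_ne
  have ndp := G.ne_of_adj ho.dp_ne
  have ndq := G.ne_of_adj ho.dq_ne
  have npr := G.ne_of_adj ho.pr_ne
  have nps := G.ne_of_adj ho.ps_ne
  have nqr := G.ne_of_adj ho.qr_ne
  have nqs := G.ne_of_adj ho.qs_ne
  have nrs := G.ne_of_adj ho.rs_ne
  have he := ho.sign_ne
  have hpd := G.symm p d
  have hqd := (G.symm q d).trans ho.dq
  have hrp := (G.symm r p).trans ho.pr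
  have hrq := (G.symm r q).trans ho.qr
  have hsp := (G.symm s p).trans ho.ps
  have hsq := (G.symm s q).trans ho.qs
  have hsr := (G.symm s r).trans ho.rs
  have ep := eq_of_three (hG p) (G.adj_symm ho.dp_ne) ho.pr_ne ho.ps_ne ndr nds nrs
  have eq := eq_of_three (hG q) (G.adj_symm ho.dq_ne) ho.qr_ne ho.qs_ne ndr nds nrs
  have er := eq_of_three (hG r) (hrp ▸ he) (hrq ▸ he) ho.rs_ne npq nps nqs
  have es := eq_of_three (hG s) (hsp ▸ he) (hsq ▸ he) (hsr ▸ he) npq npr nqr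
  obtain ⟨k, hk, m, hm, l, hl, x, hmx, hlx, y, hmy, hly, hxy⟩ : ∃ k,
      (∀ z, G d z ≠ 0 → z ≠ p → z ≠ q → rookTop k (φ z) = G d z) ∧ ∃ m, rookTop k m = G d p ∧
      ∃ l, rookTop k l = -G d p ∧ ∃ x, rookTop m x = e ∧ rookTop l x = e ∧
      ∃ y, rookTop m y = e ∧ rookTop l y = e ∧ rookTop x y = e := by
    by_cases h : ∃ t, G d t ≠ 0 ∧ t ≠ p ∧ t ≠ q
    · obtain ⟨t, ht, htp, htq⟩ := h
      obtain ⟨k, hk, h⟩ := rookTop_obstruction (φ t) _ _ e ht ho.dp_ne he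
      refine ⟨k, fun z hz hzp hzq => ?_, h⟩
      rcases eq_of_three (hG d) ho.dp_ne ho.dq_ne ht npq htp.symm htq.symm z hz with
        rfl | rfl | rfl
      · exact absurd rfl hzp
      · exact absurd rfl hzq
      · exact hk
    -- With no third edge at `d`, the outer colour and sign are arbitrary placeholders.
    · obtain ⟨k, -, h'⟩ := rookTop_obstruction none 1 _ e (by decide) ho.dp_ne he
      exact ⟨k, fun z hz hzp hzq => absurd ⟨z, hz, hzp, hzq⟩ h, h'⟩
  obtain ⟨ψ, h1, -⟩ := IsColouring.patch (G := G) rookTop_symm (φ := φ)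
    [(d, k), (p, m), (q, l), (r, x), (s, y)] (by
      intro z t hz ht
      simp only [List.map_cons, List.map_nil, List.mem_cons, List.not_mem_nil, or_false] at hz ht
      exact hφ.of_delete z t hz ht) (by simp [*]) (by
      intro ψ h2 h3
      simp only [List.mem_cons, List.not_mem_nil, or_false, forall_eq_or_imp, forall_eq,
        List.map_cons, List.map_nil, not_or, and_imp] at h2 h3 ⊢
      obtain ⟨vd, vp, vq, vr, vs⟩ := h2
      refine ⟨?_, ?_, ?_, ?_, ?_⟩
      · intro z hz
        by_cases hzp : z = p
        · rw [hzp, vp, hm]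
        by_cases hzq : z = q
        · rw [hzq, vq, hl, ho.dq]
        have hzr : z ≠ r := by
          rintro rfl
          rcases er d (G.adj_symm hz) with h | h | h
          · exact ndp h
          · exact ndq h
          · exact nds h
        have hzs : z ≠ s := by
          rintro rfl
          rcases es d (G.adj_symm hz) with h | h | h
          · exact ndp h
          · exact ndq h
          · exact ndr h
        rw [h3 z (G.ne_of_adj hz).symm hzp hzq hzr hzs]
        exact hk z hz hzp hzq
      · intro z hz
        rcases ep z hz with rfl | rfl | rfl
        · rw [vd, rookTop_symm, hm, hpd]
        · rw [vr, hmx, ho.pr]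
        · rw [vs, hmy, ho.ps]
      · intro z hz
        rcases eq z hz with rfl | rfl | rfl
        · rw [vd, rookTop_symm, hl, hqd]
        · rw [vr, hlx, ho.qr]
        · rw [vs, hly, ho.qs]
      · intro z hz
        rcases er z hz with rfl | rfl | rfl
        · rw [vp, rookTop_symm, hmx, hrp]
        · rw [vq, rookTop_symm, hlx, hrq]
        · rw [vs, hxy, ho.rs]
      · intro z hz
        rcases es z hz with rfl | rfl | rfl
        · rw [vp, rookTop_symm, hmy, hsp]
        · rw [vq, rookTop_symm, hly, hsq]
        · rw [vr, rookTop_symm, hxy, hsr])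
  exact ⟨ψ, h1⟩

/-- Subcubic graphs without cubic components map to `rookTop`. -/
theorem exists_rookTop_colouring (G : Signing V) (hG : G.Subcubic) (hP : G.Proper) :
    ∃ φ, G.IsColouring rookTop φ := by
  classical
  induction hn : (Finset.univ.filter fun z => ∃ t, G z t ≠ 0).card using
    Nat.strong_induction_on generalizing G with
  | _ n ih =>
  by_cases hU : G.Unobstructed
  · obtain ⟨φ, hφ⟩ := exists_rook_colouring G hG hP hU
    exact ⟨fun z => some (φ z), fun x y h => hφ x y h⟩
  simp only [Unobstructed, not_forall, not_not] at hU
  obtain ⟨e, d, p, q, r, s, ho⟩ := hU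
  have hsub := G.delete_sub {d, p, q, r, s}
  obtain ⟨φ, hφ⟩ := ih _ (by
    rw [← hn]
    refine Finset.card_lt_card ⟨fun z hz => ?_, fun hs => ?_⟩
    · simp only [Finset.mem_filter, Finset.mem_univ, true_and] at hz ⊢
      obtain ⟨t, ht⟩ := hz
      exact ⟨t, hsub.adj ht⟩
    · have := @hs d (by
        simp only [Finset.mem_filter, Finset.mem_univ, true_and]
        exact ⟨p, ho.dp_ne⟩)
      simp only [Finset.mem_filter, Finset.mem_univ, true_and] at this
      obtain ⟨t, ht⟩ := this
      exact (G.delete_adj ht).1 (by simp)) _ (hG.mono hsub) (hP.mono hG hsub) rfl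
  exact ho.exists_rookTop_colouring hG hφ

/-- Deleting vertices from a connected subcubic graph leaves no cubic component. -/
theorem proper_delete {G : Signing V} (hG : G.Subcubic) (hc : ∀ x y, G.Reach x y) {R : Set V}
    {v : V} (hv : v ∈ R) : (G.delete R).Proper :=
  proper_of_reach hG (fun _ _ => (G.delete_sub R).adj) fun x =>
    ⟨v, hc x v, by rw [card_nbrs_delete_of_mem _ hv]; omega⟩

/-! ### Cubic graphs and the tenth colour. -/

/-- `G` maps to a signed graph on ten vertices. -/
def TenColourable (G : Signing V) : Prop :=
  ∃ T : Option (Fin 9) → Option (Fin 9) → SignType, (∀ i j, T i j = T j i) ∧ (∀ i, T i i = 0) ∧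
    ∃ φ, G.IsColouring T φ

/-- A vertex gets a colour of its own if neighbours of equal colour are joined to it with equal
signs. -/
theorem tenColourable_of_delete {G : Signing V} {v : V} {φ : V → Fin 9}
    (hφ : (G.delete {v}).IsColouring rook φ)
    (h : ∀ x y, G v x ≠ 0 → G v y ≠ 0 → φ x = φ y → G v x = G v y) : G.TenColourable := by
  classical
  obtain ⟨g, hg⟩ : ∃ g : Fin 9 → SignType, ∀ z, G v z ≠ 0 → g (φ z) = G v z := by
    -- A colour absent from the neighbourhood of `v` may have any sign towards the new vertex; `1`
    -- is arbitrary.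
    refine ⟨fun i => if hi : ∃ z, G v z ≠ 0 ∧ φ z = i then G v hi.choose else 1, fun z hz => ?_⟩
    have hi : ∃ z', G v z' ≠ 0 ∧ φ z' = φ z := ⟨z, hz, rfl⟩
    simp only [dif_pos hi]
    exact h _ _ hi.choose_spec.1 hz hi.choose_spec.2
  let T : Option (Fin 9) → Option (Fin 9) → SignType
    | some i, some j => rook i j
    | none, none => 0
    | some i, none => g i
    | none, some i => g i
  refine ⟨T, ?_, ?_, fun z => if z = v then none else some (φ z), ?_⟩
  · rintro (_ | i) (_ | j)
    · rfl
    · rfl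
    · rfl
    · exact rook_symm i j
  · rintro (_ | i)
    · rfl
    · exact rook_self i
  · intro x y hxy
    by_cases hx : x = v
    · subst hx
      simp only [if_true, if_neg (G.ne_of_adj hxy).symm]
      exact hg y hxy
    · by_cases hy : y = v
      · subst hy
        simp only [if_true, if_neg hx]
        rw [G.symm]
        exact hg x (G.adj_symm hxy)
      · simp only [if_neg hx, if_neg hy]
        exact hφ.of_delete x y hx hy hxy

/-- The edges at `u` other than `uv` have the same sign. -/
def SameOff (G : Signing V) (u v : V) : Prop :=
  G u v ≠ 0 ∧ ∀ z t, G u z ≠ 0 → G u t ≠ 0 → z ≠ v → t ≠ v → G u z = G u t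

/-- If `x` were related to two vertices, comparison with its third neighbour would make all edges at
`x` equal in sign. So each `x` is related to at most one `v`, and not every `v` can be related to
two vertices. -/
theorem exists_few_sameOff [Nonempty V] {G : Signing V} (hG : ∀ x, (G.nbrs x).card = 3)
    (hu : ∀ v, ∃ x y, G v x ≠ 0 ∧ G v y ≠ 0 ∧ G v x ≠ G v y) :
    ∃ v, ∀ x y, G.SameOff x v → G.SameOff y v → x = y := by
  classical
  by_contra hcon
  simp only [not_exists, not_forall] at hcon
  have h1 : ∀ v ∈ (Finset.univ : Finset V),
      2 ≤ (Finset.univ.bipartiteBelow (fun x v => G.SameOff x v) v).card := by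
    intro v _
    obtain ⟨x, y, hx, hy, hxy⟩ := hcon v
    exact Finset.one_lt_card.2 ⟨x, by simpa [Finset.bipartiteBelow] using hx, y,
      by simpa [Finset.bipartiteBelow] using hy, hxy⟩
  have h2 : ∀ x ∈ (Finset.univ : Finset V),
      (Finset.univ.bipartiteAbove (fun x v => G.SameOff x v) x).card ≤ 1 := by
    intro x _
    refine Finset.card_le_one.2 fun v hv w hw => ?_
    simp only [Finset.bipartiteAbove, Finset.mem_filter, Finset.mem_univ, true_and] at hv hw
    by_contra hvw
    obtain ⟨y, z, hy, hz, hyz⟩ := hu x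
    obtain ⟨t, ht, htv, htw⟩ : ∃ t, G x t ≠ 0 ∧ t ≠ v ∧ t ≠ w := by
      obtain ⟨t, ht, ht'⟩ := Finset.exists_mem_notMem_of_card_lt_card
        (s := {v, w}) (t := G.nbrs x) (by
          rw [hG x]
          exact lt_of_le_of_lt Finset.card_le_two (by omega))
      simp only [Finset.mem_insert, Finset.mem_singleton, not_or] at ht'
      exact ⟨t, mem_nbrs.1 ht, ht'.1, ht'.2⟩
    have hall : ∀ b, G x b ≠ 0 → G x b = G x t := by
      intro b hb
      by_cases hbv : b = v
      · exact hw.2 b t hb ht (by rw [hbv]; exact hvw) htw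
      · exact hv.2 b t hb ht hbv htv
    exact hyz ((hall y hy).trans (hall z hz).symm)
  have h3 := Finset.card_mul_le_card_mul' (fun x v => G.SameOff x v) h1 h2
  have h4 : 0 < (Finset.univ : Finset V).card := Finset.card_pos.2 Finset.univ_nonempty
  omega

/-- Recolour a neighbour of a deleted vertex whose other two edges differ in sign. -/
theorem IsColouring.recolour_nbr {G : Signing V} (hG : G.Subcubic) {v x : V} {φ : V → Fin 9}
    (hφ : (G.delete {v}).IsColouring rook φ) (hx : G v x ≠ 0) (hs : ¬ G.SameOff x v) (f : Fin 9) :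
    ∃ ψ, (G.delete {v}).IsColouring rook ψ ∧ ψ x ≠ f ∧ ∀ z, z ≠ x → ψ z = φ z := by
  have hxv := G.adj_symm hx
  have hd : ((G.delete {v}).nbrs x).card ≤ 2 := by
    have := G.card_nbrs_delete_lt (R := {v}) rfl hxv
    have := hG x
    omega
  refine IsColouring.recolour (fun z t _ _ h => hφ z t h) hd
    (fun z t hz ht h => hφ.sign_eq hz ht h) ?_ f
  -- The rigid case needs equal signs on the two remaining edges at `x`, which `hs` excludes.
  intro z t hz ht hzt hs'
  exfalso
  refine hs ⟨hxv, fun b c hb hc hbv hcv => ?_⟩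
  have hsub := G.delete_sub {v}
  rw [← hsub _ _ hz, ← hsub _ _ ht] at hs'
  have hxne := G.ne_of_adj hxv
  have e := eq_of_two hd hz ht hzt
  have hall : ∀ b, G x b ≠ 0 → b ≠ v → G x b = G x z := by
    intro b hb hbv
    rcases e b (by rwa [delete_apply G (R := {v}) hxne hbv]) with rfl | rfl
    · rfl
    · exact hs'.symm
  exact (hall b hb hbv).trans (hall c hc hcv).symm

theorem tenColourable_of_odd {G : Signing V} (hG : G.Subcubic) {v a b c : V} {φ : V → Fin 9}
    (hφ : (G.delete {v}).IsColouring rook φ) (ha : G v a ≠ 0) (hb : G v b ≠ 0) (hc : G v c ≠ 0)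
    (hab : a ≠ b) (hac : a ≠ c) (hbc : b ≠ c) (hs : G v b = G v c)
    (hv : ∀ x y, G.SameOff x v → G.SameOff y v → x = y) : G.TenColourable := by
  suffices h : ∃ ψ, (G.delete {v}).IsColouring rook ψ ∧ ψ a ≠ ψ b ∧ ψ a ≠ ψ c by
    obtain ⟨ψ, hψ, h1, h2⟩ := h
    refine tenColourable_of_delete hψ fun x y hx hy hxy => ?_
    rcases eq_of_three (hG v) ha hb hc hab hac hbc x hx with rfl | rfl | rfl <;>
      rcases eq_of_three (hG v) ha hb hc hab hac hbc y hy with rfl | rfl | rfl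
    · rfl
    · exact absurd hxy h1
    · exact absurd hxy h2
    · exact absurd hxy.symm h1
    · rfl
    · exact hs
    · exact absurd hxy.symm h2
    · exact hs.symm
    · rfl
  -- At most one neighbour of `v` resists recolouring. It keeps its colour, and two others are moved
  -- in turn.
  by_cases hsa : G.SameOff a v
  · obtain ⟨ψ, h1, h2, h3⟩ := hφ.recolour_nbr hG hb (fun h => hab (hv _ _ hsa h)) (φ a)
    obtain ⟨χ, h4, h5, h6⟩ := h1.recolour_nbr hG hc (fun h => hac (hv _ _ hsa h)) (φ a)
    refine ⟨χ, h4, ?_, ?_⟩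
    · rw [h6 a hac, h6 b hbc, h3 a hab]
      exact h2.symm
    · rw [h6 a hac, h3 a hab]
      exact h5.symm
  · by_cases hsb : G.SameOff b v
    · obtain ⟨ψ, h1, h2, h3⟩ := hφ.recolour_nbr hG ha hsa (φ b)
      obtain ⟨χ, h4, h5, h6⟩ := h1.recolour_nbr hG hc (fun h => hbc (hv _ _ hsb h)) (ψ a)
      refine ⟨χ, h4, ?_, ?_⟩
      · rwa [h6 a hac, h6 b hbc, h3 b hab.symm]
      · rw [h6 a hac]
        exact h5.symm
    · obtain ⟨ψ, h1, h2, h3⟩ := hφ.recolour_nbr hG ha hsa (φ c)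
      obtain ⟨χ, h4, h5, h6⟩ := h1.recolour_nbr hG hb hsb (ψ a)
      refine ⟨χ, h4, ?_, ?_⟩
      · rw [h6 a hab]
        exact h5.symm
      · rwa [h6 a hab, h6 c hbc.symm, h3 c hac.symm]

/-- Connected cubic graphs map to signed graphs on ten vertices. -/
theorem tenColourable_of_cubic [Nonempty V] {G : Signing V} (hG : ∀ x, (G.nbrs x).card = 3)
    (hc : ∀ x y, G.Reach x y) : G.TenColourable := by
  have hS : G.Subcubic := fun x => (hG x).le
  by_cases hU : G.Unobstructed
  swap
  · simp only [Unobstructed, not_forall, not_not] at hU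
    obtain ⟨e, d, p, q, r, s, ho⟩ := hU
    obtain ⟨φ, hφ⟩ := exists_rookTop_colouring (G.delete {d, p, q, r, s})
      (hS.mono (G.delete_sub _)) (proper_delete hS hc (v := d) (by simp))
    exact ⟨rookTop, rookTop_symm, rookTop_self, ho.exists_rookTop_colouring hS hφ⟩
  have hdel : ∀ v, ∃ φ, (G.delete {v}).IsColouring rook φ := fun v =>
    exists_rook_colouring _ (hS.mono (G.delete_sub _)) (proper_delete hS hc rfl)
      (hU.mono (G.delete_sub _))
  by_cases hu : ∀ v, ∃ x y, G v x ≠ 0 ∧ G v y ≠ 0 ∧ G v x ≠ G v y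
  · obtain ⟨v, hv⟩ := exists_few_sameOff hG hu
    obtain ⟨φ, hφ⟩ := hdel v
    classical
    obtain ⟨x, y, z, hxy, hxz, hyz, hn⟩ := Finset.card_eq_three.1 (hG v)
    have hx : G v x ≠ 0 := by rw [← mem_nbrs, hn]; simp
    have hy : G v y ≠ 0 := by rw [← mem_nbrs, hn]; simp
    have hz : G v z ≠ 0 := by rw [← mem_nbrs, hn]; simp
    by_cases h1 : G v x = G v y
    · exact tenColourable_of_odd hS hφ hz hx hy hxz.symm hyz.symm hxy h1 hv
    by_cases h2 : G v x = G v z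
    · exact tenColourable_of_odd hS hφ hy hx hz hxy.symm hyz hxz h2 hv
    have h3 : G v y = G v z := by
      have h4 := sign_eq_neg_of_ne _ _ hy hx (Ne.symm h1)
      have h5 := sign_eq_neg_of_ne _ _ hz hx (Ne.symm h2)
      rw [h4, h5]
    exact tenColourable_of_odd hS hφ hx hy hz hxy hxz hyz h3 hv
  · simp only [not_forall, not_exists, not_and, not_not, ne_eq] at hu
    obtain ⟨v, hv⟩ := hu
    obtain ⟨φ, hφ⟩ := hdel v
    exact tenColourable_of_delete hφ fun x y hx hy _ => hv x y hx hy

end Signing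

/-! ### Translation to 2-edge-coloured graphs. -/

namespace TwoEdgeColouredGraph

open Classical in
/-- The signed adjacency matrix of a 2-edge-coloured graph. -/
noncomputable def toSigning (G : TwoEdgeColouredGraph.{u}) : Signing G.V where
  sgn x y := if h : G.graph.Adj x y then
    (if G.sign ⟨s(x, y), h⟩ = EdgeColour.pos then 1 else -1) else 0
  symm x y := by
    by_cases h : G.graph.Adj x y
    · have : (⟨s(x, y), h⟩ : G.graph.edgeSet) = ⟨s(y, x), h.symm⟩ := Subtype.ext Sym2.eq_swap
      rw [dif_pos h, dif_pos h.symm, this]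
    · rw [dif_neg h, dif_neg fun h' => h h'.symm]
  irrefl x := dif_neg (G.graph.loopless.irrefl x)

theorem toSigning_of_adj (G : TwoEdgeColouredGraph.{u}) {x y : G.V} (h : G.graph.Adj x y) :
    G.toSigning x y = if G.sign ⟨s(x, y), h⟩ = EdgeColour.pos then 1 else -1 :=
  dif_pos h

theorem toSigning_ne_zero (G : TwoEdgeColouredGraph.{u}) {x y : G.V} :
    G.toSigning x y ≠ 0 ↔ G.graph.Adj x y := by
  by_cases h : G.graph.Adj x y
  · rw [toSigning_of_adj G h]
    simp only [h, iff_true]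
    split_ifs <;> decide
  · simp [toSigning, h]

/-- The 2-edge-coloured graph with a given signed adjacency matrix. -/
def ofMatrix {C : Type u} [Fintype C] (T : C → C → SignType) (hT : ∀ i j, T i j = T j i)
    (h0 : ∀ i, T i i = 0) : TwoEdgeColouredGraph.{u} where
  V := C
  graph := { Adj := fun i j => T i j ≠ 0
             symm := ⟨fun i j h => by rwa [hT]⟩
             loopless := ⟨fun i h => h (h0 i)⟩ }
  sign e := if Sym2.lift ⟨T, hT⟩ e.1 = 1 then EdgeColour.pos else EdgeColour.neg

theorem colourable_of_isColouring (G : TwoEdgeColouredGraph.{u}) {C : Type} [Fintype C]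
    {T : C → C → SignType} (hT : ∀ i j, T i j = T j i) (h0 : ∀ i, T i i = 0) {φ : G.V → C}
    (hφ : G.toSigning.IsColouring T φ) : G.Colourable (Fintype.card C) := by
  refine ⟨ofMatrix T hT h0, rfl, ⟨φ, fun {x y} h => ?_⟩, ?_⟩
  · change T (φ x) (φ y) ≠ 0
    rw [hφ x y (G.toSigning_ne_zero.2 h)]
    exact G.toSigning_ne_zero.2 h
  · rintro ⟨e, he⟩
    induction e using Sym2.ind with
    | _ x y =>
      change G.sign ⟨s(x, y), he⟩ =
        if T (φ x) (φ y) = 1 then EdgeColour.pos else EdgeColour.neg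
      rw [hφ x y (G.toSigning_ne_zero.2 he), toSigning_of_adj G he]
      cases G.sign ⟨s(x, y), he⟩ <;> decide

theorem colourable_ten {G : TwoEdgeColouredGraph.{u}} (hG : G ∈ connectedCubic) :
    G.Colourable 10 := by
  classical
  obtain ⟨hc, hr⟩ := hG
  have := hc.nonempty
  obtain ⟨T, hT, h0, φ, hφ⟩ := Signing.tenColourable_of_cubic (G := G.toSigning) (by
    intro x
    rw [← hr x, SimpleGraph.degree]
    congr 1
    ext y
    rw [Signing.mem_nbrs, toSigning_ne_zero, SimpleGraph.mem_neighborFinset]) (by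
    intro x y
    have h := (SimpleGraph.reachable_iff_reflTransGen x y).1 (hc.preconnected x y)
    exact Relation.ReflTransGen.mono (fun _ _ h => G.toSigning_ne_zero.2 h) _ _ h)
  simpa using colourable_of_isColouring G hT h0 hφ

/-! ### The lower bound. -/

/-- A cubic signed graph on eight vertices in which any two nonadjacent vertices have a common
neighbour, joined to them with different signs. -/
def octaMatrix : Fin 8 → Fin 8 → SignType :=
  ![![0, 1, 1, -1, 0, 0, 0, 0],
    ![1, 0, 0, 0, 1, -1, 0, 0],
    ![1, 0, 0, 0, -1, 0, -1, 0],
    ![-1, 0, 0, 0, 0, -1, 0, 1],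
    ![0, 1, -1, 0, 0, 0, 0, -1],
    ![0, -1, 0, -1, 0, 0, 1, 0],
    ![0, 0, -1, 0, 0, 1, 0, 1],
    ![0, 0, 0, 1, -1, 0, 1, 0]]

theorem octaMatrix_symm : ∀ i j, octaMatrix i j = octaMatrix j i := by decide

theorem octaMatrix_self : ∀ i, octaMatrix i i = 0 := by decide

/-- Identifying two vertices would create a loop or an edge with two signs, so every homomorphism
from this graph is injective. The same property gives connectedness with paths of length at most
two. -/
theorem octaMatrix_clique : ∀ i j, i ≠ j → octaMatrix i j ≠ 0 ∨ ∃ k, octaMatrix i k ≠ 0 ∧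
    octaMatrix j k ≠ 0 ∧ octaMatrix i k = -octaMatrix j k := by decide

theorem octaMatrix_degree : ∀ i, (Finset.univ.filter fun j => octaMatrix i j ≠ 0).card = 3 := by
  decide

/-- The 2-edge-coloured graph of `octaMatrix`. -/
def octa : TwoEdgeColouredGraph.{u} :=
  ofMatrix (C := ULift.{u} (Fin 8)) (fun i j => octaMatrix i.down j.down)
    (fun i j => octaMatrix_symm i.down j.down) (fun i => octaMatrix_self i.down)

theorem octa_sign {i j : ULift.{u} (Fin 8)} (h : octa.{u}.graph.Adj i j) :
    octa.{u}.sign ⟨s(i, j), h⟩ =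
      if octaMatrix i.down j.down = 1 then EdgeColour.pos else EdgeColour.neg := rfl

theorem octa_mem : octa.{u} ∈ connectedCubic.{u} := by
  classical
  refine ⟨?_, ?_⟩
  · have : Nonempty octa.{u}.V := ⟨(⟨0⟩ : ULift (Fin 8))⟩
    refine SimpleGraph.Connected.mk fun (i j : ULift (Fin 8)) => ?_
    by_cases hij : i = j
    · exact hij ▸ SimpleGraph.Reachable.refl _
    · rcases octaMatrix_clique i.down j.down (fun h => hij (ULift.ext _ _ h)) with h | ⟨k, h1, h2, -⟩
      · exact SimpleGraph.Adj.reachable (G := octa.{u}.graph) h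
      · have h1' : octa.{u}.graph.Adj i (⟨k⟩ : ULift (Fin 8)) := h1
        have h2' : octa.{u}.graph.Adj j (⟨k⟩ : ULift (Fin 8)) := h2
        exact h1'.reachable.trans h2'.symm.reachable
  · intro i
    let d : octa.{u}.V → Fin 8 := ULift.down
    have hd : ∀ j k, octa.{u}.graph.Adj j k ↔ octaMatrix (d j) (d k) ≠ 0 := fun _ _ => Iff.rfl
    have hinj : Function.Injective d := ULift.down_injective
    have hsurj : Function.Surjective d := ULift.down_surjective
    clear_value d
    rw [← octaMatrix_degree (d i), SimpleGraph.degree]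
    refine Finset.card_bij (fun j _ => d j) ?_ (fun j _ k _ h => hinj h) ?_
    · intro j hj
      rw [SimpleGraph.mem_neighborFinset, hd] at hj
      simpa using hj
    · intro j hj
      obtain ⟨k, rfl⟩ := hsurj j
      refine ⟨k, ?_, rfl⟩
      rw [SimpleGraph.mem_neighborFinset, hd]
      exact (Finset.mem_filter.1 hj).2

theorem eight_le_of_octa_colourable {n : ℕ} (h : octa.{u}.Colourable n) : 8 ≤ n := by
  obtain ⟨H, rfl, φ, hφ⟩ := h
  have hinj : Function.Injective fun i : Fin 8 => φ (⟨i⟩ : ULift (Fin 8)) := by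
    intro i j hij
    by_contra hne
    rcases octaMatrix_clique i j hne with h | ⟨k, h1, h2, h3⟩
    · have h' : octa.{u}.graph.Adj (⟨i⟩ : ULift (Fin 8)) (⟨j⟩ : ULift (Fin 8)) := h
      exact (φ.map_adj h').ne hij
    · have h1' : octa.{u}.graph.Adj (⟨i⟩ : ULift (Fin 8)) (⟨k⟩ : ULift (Fin 8)) := h1
      have h2' : octa.{u}.graph.Adj (⟨j⟩ : ULift (Fin 8)) (⟨k⟩ : ULift (Fin 8)) := h2
      have e1 := hφ ⟨s((⟨i⟩ : ULift (Fin 8)), (⟨k⟩ : ULift (Fin 8))), h1'⟩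
      have e2 := hφ ⟨s((⟨j⟩ : ULift (Fin 8)), (⟨k⟩ : ULift (Fin 8))), h2'⟩
      have e3 : φ.mapEdgeSet ⟨s((⟨i⟩ : ULift (Fin 8)), (⟨k⟩ : ULift (Fin 8))), h1'⟩ =
          φ.mapEdgeSet ⟨s((⟨j⟩ : ULift (Fin 8)), (⟨k⟩ : ULift (Fin 8))), h2'⟩ := by
        refine Subtype.ext ?_
        change s(φ (⟨i⟩ : ULift (Fin 8)), φ (⟨k⟩ : ULift (Fin 8))) =
          s(φ (⟨j⟩ : ULift (Fin 8)), φ (⟨k⟩ : ULift (Fin 8)))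
        rw [show φ (⟨i⟩ : ULift (Fin 8)) = φ (⟨j⟩ : ULift (Fin 8)) from hij]
      rw [e3, ← e2, octa_sign h1', octa_sign h2'] at e1
      change (if octaMatrix i k = 1 then EdgeColour.pos else EdgeColour.neg) =
        if octaMatrix j k = 1 then EdgeColour.pos else EdgeColour.neg at e1
      rw [h3] at e1
      revert e1 h2
      generalize octaMatrix j k = t
      revert t
      decide
  simpa using Fintype.card_le_of_injective _ hinj

theorem octa_colourable : octa.{u}.Colourable 8 := by
  have := colourable_of_isColouring octa.{u} (T := octaMatrix) octaMatrix_symm octaMatrix_self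
    (φ := fun i : ULift (Fin 8) => i.down) (by
      intro (i : ULift (Fin 8)) (j : ULift (Fin 8)) hij
      have h : octa.{u}.graph.Adj i j := octa.{u}.toSigning_ne_zero.1 hij
      have h' : octaMatrix i.down j.down ≠ 0 := h
      rw [toSigning_of_adj _ h, octa_sign h]
      revert h'
      generalize octaMatrix i.down j.down = t
      revert t
      decide)
  simpa using this

theorem chromaticNumber_octa : octa.{u}.chromaticNumber = 8 := by
  refine le_antisymm (sInf_le ⟨8, rfl, octa_colourable⟩) (le_sInf ?_)
  rintro k ⟨n, rfl, hn⟩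
  exact_mod_cast eight_le_of_octa_colourable hn

end TwoEdgeColouredGraph

theorem mainTheorem2 :
    8 ≤ TwoEdgeColouredGraph.familyChromaticNumber TwoEdgeColouredGraph.connectedCubic.{u} ∧
    TwoEdgeColouredGraph.familyChromaticNumber TwoEdgeColouredGraph.connectedCubic.{u} ≤ 10 ∧
    ∃ G ∈ TwoEdgeColouredGraph.connectedCubic.{u}, G.chromaticNumber = 8 := by
  refine ⟨le_sInf fun k hk => ?_, sInf_le fun G hG => sInf_le ⟨10, rfl, ?_⟩,
    TwoEdgeColouredGraph.octa, TwoEdgeColouredGraph.octa_mem,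
    TwoEdgeColouredGraph.chromaticNumber_octa⟩
  · rw [← TwoEdgeColouredGraph.chromaticNumber_octa.{u}]
    exact hk _ TwoEdgeColouredGraph.octa_mem
  · exact TwoEdgeColouredGraph.colourable_ten hG
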